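/- For a finite simple graph $G$ let $c_i(G)$ be the number of cliques on $i$ vertices of $G$, and let $\binom{n}{k}_r := c_k(T_{n,r})$, where $T_{n,r}$ is the Turán graph on $n$ vertices with $r$ parts. Let $k$ and $m$ be positive integers. Write $m$ uniquely as $$m=\binom{n_k}{k}+\binom{n_{k-1}}{k-1}+\dots+\binom{n_{k-s}}{k-s},\qquad s\ge 0,\quad n_k>n_{k-1}>\dots>n_{k-s}\ge k-s>0,$$ and define the Kruskal–Katona bound $$\mathrm{oldbd}_k(m):=\binom{n_k}{k+1}+\binom{n_{k-1}}{k}+\dots+\binom{n_{k-s}}{k-s+1}.$$ Here $n_k$ is the largest integer $n$ with $\binom nk\le m$, that is, the largest possible number of vertices of a clique in a graph with exactly $m$ cliques on $k$ vertices. One has $\mathrm{oldbd}_k(m)>0$ if and only if $n_k>k$, and in this case put $r:=n_k-1$, write $m$ uniquely as $$m=\binom{a_k}{k}_{r}+\binom{a_{k-1}}{k-1}_{r-1}+\dots+\binom{a_{k-t}}{k-t}_{r-t}$$ with $t\ge 0$, $a_{k-i}-\big\lfloor \tfrac{a_{k-i}}{r-i}\big\rfloor>a_{k-i-1}$ for $0\le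 i<t$, and $a_{k-t}\ge k-t>0$, and define $$\mathrm{smbd}_k(m):=\binom{a_k}{k+1}_{r}+\binom{a_{k-1}}{k}_{r-1}+\dots+\binom{a_{k-t}}{k-t+1}_{r-t}.$$ **Proposition 4.5.** If $\mathrm{oldbd}_k(m)>0$, then $\mathrm{smbd}_k(m)<\mathrm{oldbd}_k(m)$. Consequently, if $\mathrm{oldbd}_k(m)>0$, then every finite simple graph $G$ with $c_k(G)=m$ that has no clique on $n_k$ vertices satisfies $c_{k+1}(G)<\mathrm{oldbd}_k(m)$, so that it does not attain the Kruskal–Katona bound. -/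

import Mathlib

/-- The number `c_i(G)` of cliques on `i` vertices of a graph `G`. -/
noncomputable def cliqueCount {V : Type*} (G : SimpleGraph V) (i : ℕ) : ℕ :=
  (G.cliqueSet i).ncard

/-- `r_k(n_k, n_{k-1}, …, n_{k-s}) = C(n_k, k) + C(n_{k-1}, k-1) + … + C(n_{k-s}, k-s)`,
where the list is `[n_k, n_{k-1}, …, n_{k-s}]`. -/
def binomSum : ℕ → List ℕ → ℕ
  | _, [] => 0
  | k, n :: L => n.choose k + binomSum (k - 1) L

/-- `IsBinomRep k [n_k, n_{k-1}, …, n_{k-s}]` says that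
`n_k > n_{k-1} > … > n_{k-s} ≥ k - s > 0` (with `s ≥ 0`, so that the list is nonempty). -/
inductive IsBinomRep : ℕ → List ℕ → Prop
  | single {k n : ℕ} (hk : 0 < k) (hn : k ≤ n) : IsBinomRep k [n]
  | cons {k n n' : ℕ} {L : List ℕ} (hn : n' < n) (h : IsBinomRep k (n' :: L)) :
      IsBinomRep (k + 1) (n :: n' :: L)

/-- The number of `k`-cliques of the Turán graph on `n` vertices with `r` parts. -/
noncomputable def turanBinom (n k r : ℕ) : ℕ :=
  cliqueCount (SimpleGraph.turanGraph n r) k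

/-- For the list `[a_k, a_{k-1}, …, a_{k-s}]`, the sum
`C(a_k, k)_r + C(a_{k-1}, k-1)_{r-1} + … + C(a_{k-s}, k-s)_{r-s}`,
where `C(n, k)_r` is `turanBinom n k r`. -/
noncomputable def turanSum : ℕ → ℕ → List ℕ → ℕ
  | _, _, [] => 0
  | k, r, n :: L => turanBinom n k r + turanSum (k - 1) (r - 1) L

/-- `IsTuranRep k r [a_k, a_{k-1}, …, a_{k-s}]` says that
`a_{k-i} - ⌊a_{k-i} / (r - i)⌋ > a_{k-i-1}` for `0 ≤ i < s`, and `a_{k-s} ≥ k - s > 0`. -/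
inductive IsTuranRep : ℕ → ℕ → List ℕ → Prop
  | single {k r n : ℕ} (hk : 0 < k) (hn : k ≤ n) : IsTuranRep k r [n]
  | cons {k r n n' : ℕ} {L : List ℕ} (hn : n' < n - n / (r + 1))
      (h : IsTuranRep k r (n' :: L)) : IsTuranRep (k + 1) (r + 1) (n :: n' :: L)

open Classical in
/-- The list `[n_k, n_{k-1}, …]` of the unique representation `m = r_k(n_k, n_{k-1}, …)`
(see `existsUnique_binomRep`; the empty list if `k = 0` or `m = 0`). -/
noncomputable def binomRep (k m : ℕ) : List ℕ :=
  if h : ∃ L, IsBinomRep k L ∧ binomSum k L = m then h.choose else []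

/-- The leading term `n_k` of the representation `m = r_k(n_k, n_{k-1}, …)`. -/
noncomputable def leadingTerm (k m : ℕ) : ℕ := (binomRep k m).headD 0

/-- The Kruskal–Katona bound: `r_{k+1}(n_k, n_{k-1}, …)`, where `m = r_k(n_k, n_{k-1}, …)`. -/
noncomputable def oldbd (k m : ℕ) : ℕ := binomSum (k + 1) (binomRep k m)

open Classical in
/-- The list `[a_k, a_{k-1}, …]` of the unique representation
`m = C(a_k, k)_r + C(a_{k-1}, k-1)_{r-1} + …` (see `existsUnique_turanRep`; it exists whenever
`k, m > 0` and `r ≥ k`). -/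
noncomputable def turanRep (k r m : ℕ) : List ℕ :=
  if h : ∃ L, IsTuranRep k r L ∧ turanSum k r L = m then h.choose else []

/-- The bound for graphs without an `n_k`-clique:
`C(a_k, k+1)_{n_k-1} + C(a_{k-1}, k)_{n_k-2} + …`, where
`m = C(a_k, k)_{n_k-1} + C(a_{k-1}, k-1)_{n_k-2} + …`. It is meaningful only for `n_k > k`,
that is, for `0 < oldbd k m`; see `oldbd_pos_iff`. -/
noncomputable def smbd (k m : ℕ) : ℕ :=
  turanSum (k + 1) (leadingTerm k m - 1) (turanRep k (leadingTerm k m - 1) m)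

/-! The remaining facts show that the representations exist and are unique. -/

theorem IsBinomRep.bounds {k : ℕ} {L : List ℕ} (h : IsBinomRep k L) :
    0 < k ∧ k ≤ L.headD 0 ∧ (L.headD 0).choose k ≤ binomSum k L ∧
      binomSum k L < (L.headD 0 + 1).choose k := by
  induction h with
  | @single k n hk hn =>
    obtain ⟨k, rfl⟩ : ∃ j, k = j + 1 := ⟨k - 1, by omega⟩
    have : 0 < n.choose k := Nat.choose_pos (by omega)
    simp only [List.headD_cons, binomSum, Nat.choose_succ_succ']
    omega
  | @cons k n n' L hn h ih =>
    simp only [List.headD_cons] at ih ⊢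
    obtain ⟨h1, h2, h3, h4⟩ := ih
    have h5 : (n' + 1).choose k ≤ n.choose k := Nat.choose_le_choose k hn
    refine ⟨by omega, by omega, ?_, ?_⟩
    · rw [binomSum]; omega
    · rw [binomSum, Nat.choose_succ_succ' n k, Nat.add_sub_cancel]; omega

theorem IsBinomRep.unique {k : ℕ} {L L' : List ℕ} (h : IsBinomRep k L) (h' : IsBinomRep k L')
    (e : binomSum k L = binomSum k L') : L = L' := by
  have key : L.headD 0 = L'.headD 0 := by
    have b := h.bounds
    have b' := h'.bounds
    rcases lt_trichotomy (L.headD 0) (L'.headD 0) with hlt | heq | hlt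
    · have := Nat.choose_le_choose k (Nat.succ_le_of_lt hlt)
      simp only [Nat.succ_eq_add_one] at this
      omega
    · exact heq
    · have := Nat.choose_le_choose k (Nat.succ_le_of_lt hlt)
      simp only [Nat.succ_eq_add_one] at this
      omega
  induction h generalizing L' with
  | @single k n hk hn =>
    cases h' with
    | single _ _ => simp_all
    | @cons k a a' T ha ht =>
      have b := ht.bounds
      have : 0 < a'.choose k := Nat.choose_pos b.2.1
      simp only [List.headD_cons, binomSum, Nat.add_sub_cancel] at *
      subst key
      omega
  | @cons k n n' T hn h ih =>
    cases h' with
    | single _ _ =>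
      have b := h.bounds
      have : 0 < n'.choose k := Nat.choose_pos b.2.1
      simp only [List.headD_cons, binomSum, Nat.add_sub_cancel] at *
      subst key
      omega
    | @cons _ a a' T' ha ht =>
      simp only [List.headD_cons] at key
      subst key
      have e' : binomSum k (n' :: T) = binomSum k (a' :: T') := by
        rw [binomSum, binomSum.eq_def (k + 1) (n :: a' :: T')] at e
        simp only [Nat.add_sub_cancel] at e
        omega
      have := ih ht e' (by
        have b := h.bounds
        have b' := ht.bounds
        simp only [List.headD_cons] at *
        rcases lt_trichotomy n' a' with hlt | heq | hlt
        · have := Nat.choose_le_choose k (Nat.succ_le_of_lt hlt)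
          simp only [Nat.succ_eq_add_one] at this
          omega
        · exact heq
        · have := Nat.choose_le_choose k (Nat.succ_le_of_lt hlt)
          simp only [Nat.succ_eq_add_one] at this
          omega)
      rw [this]

theorem exists_binomRep (k m : ℕ) (hk : 0 < k) (hm : 0 < m) :
    ∃ L, IsBinomRep k L ∧ binomSum k L = m := by
  induction k, hk using Nat.le_induction generalizing m with
  | base => exact ⟨[m], .single one_pos hm, by simp [binomSum]⟩
  | succ k hk ih =>
    have hex : ∃ n, m < (n + 1).choose (k + 1) := by
      refine ⟨m + k, ?_⟩
      have : (m + k + 1).choose (k + 1) ≥ m + 1 := by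
        clear ih hm
        induction m with
        | zero => simp
        | succ m ih =>
          have h0 : 0 < (m + 1 + k).choose k := Nat.choose_pos (by omega)
          rw [Nat.choose_succ_succ']
          have : m + 1 + k = m + k + 1 := by omega
          rw [this] at h0 ⊢
          omega
      omega
    classical
    obtain ⟨n, hn, hmin⟩ : ∃ n, m < (n + 1).choose (k + 1) ∧ n.choose (k + 1) ≤ m := by
      refine ⟨Nat.find hex, Nat.find_spec hex, ?_⟩
      rcases Nat.eq_zero_or_pos (Nat.find hex) with h0 | hpos
      · rw [h0]; simp
      · have := Nat.find_min hex (m := Nat.find hex - 1) (by omega)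
        rw [Nat.sub_add_cancel hpos] at this
        omega
    have hkn : k + 1 ≤ n := by
      by_contra hlt
      have : (n + 1).choose (k + 1) ≤ (k + 1).choose (k + 1) :=
        Nat.choose_le_choose _ (by omega)
      rw [Nat.choose_self] at this
      omega
    rcases hmin.eq_or_lt with heq | hlt
    · exact ⟨[n], .single (by omega) hkn, by simpa [binomSum] using heq⟩
    · obtain ⟨L, hL, hs⟩ := ih (m - n.choose (k + 1)) (by omega)
      have b := hL.bounds
      match L, hL with
      | n' :: T, hL =>
        refine ⟨n :: n' :: T, .cons ?_ hL, ?_⟩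
        · simp only [List.headD_cons] at b
          by_contra hge
          have := Nat.choose_le_choose k (not_lt.mp hge)
          rw [Nat.choose_succ_succ'] at hn
          omega
        · rw [binomSum, Nat.add_sub_cancel, hs]; omega

theorem existsUnique_binomRep (k m : ℕ) (hk : 0 < k) (hm : 0 < m) :
    ∃! L, IsBinomRep k L ∧ binomSum k L = m := by
  obtain ⟨L, hL, hs⟩ := exists_binomRep k m hk hm
  exact ⟨L, ⟨hL, hs⟩, fun L' h' => h'.1.unique hL (h'.2.trans hs.symm)⟩

theorem binomRep_spec (k m : ℕ) (hk : 0 < k) (hm : 0 < m) :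
    IsBinomRep k (binomRep k m) ∧ binomSum k (binomRep k m) = m := by
  have h := exists_binomRep k m hk hm
  rw [binomRep, dif_pos h]
  exact h.choose_spec

/-- `n_k` is the largest `n` such that a clique on `n` vertices has at most `m` cliques on `k`
vertices. -/
theorem leadingTerm_isGreatest (k m : ℕ) (hk : 0 < k) (hm : 0 < m) :
    IsGreatest {n : ℕ | n.choose k ≤ m} (leadingTerm k m) := by
  obtain ⟨h, hs⟩ := binomRep_spec k m hk hm
  have b := h.bounds
  rw [hs] at b
  refine ⟨b.2.2.1, fun n hn => ?_⟩
  by_contra hlt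
  have := Nat.choose_le_choose k (Nat.succ_le_of_lt (not_le.mp hlt))
  simp only [Set.mem_ofPred_eq, leadingTerm, Nat.succ_eq_add_one] at hn this
  omega

theorem IsBinomRep.binomSum_succ_eq_zero {k : ℕ} {L : List ℕ} (h : IsBinomRep k L)
    (hL : L.headD 0 ≤ k) : binomSum (k + 1) L = 0 := by
  induction h with
  | @single k n hk hn =>
    simp only [List.headD_cons] at hL
    simp [binomSum, Nat.choose_eq_zero_of_lt (show n < k + 1 by omega)]
  | @cons k n n' L hn h ih =>
    simp only [List.headD_cons] at hL ih
    rw [binomSum, Nat.choose_eq_zero_of_lt (show n < k + 1 + 1 by omega), Nat.add_sub_cancel,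
      ih (by omega)]

/-- The Kruskal–Katona bound is positive exactly if `n_k > k`, that is, if `smbd k m` is
meaningful. -/
theorem oldbd_pos_iff (k m : ℕ) (hk : 0 < k) (hm : 0 < m) :
    0 < oldbd k m ↔ k < leadingTerm k m := by
  obtain ⟨h, -⟩ := binomRep_spec k m hk hm
  constructor
  · intro hp
    by_contra hle
    have := h.binomSum_succ_eq_zero (not_lt.mp hle)
    rw [oldbd] at hp
    omega
  · intro hlt
    rw [leadingTerm] at hlt
    rw [oldbd]
    generalize binomRep k m = L at *
    cases h with
    | single _ _ =>
      simp only [List.headD_cons] at hlt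
      have := Nat.choose_pos (Nat.succ_le_of_lt hlt)
      simp only [binomSum]
      omega
    | @cons k _ _ _ _ _ =>
      simp only [List.headD_cons] at hlt
      have := Nat.choose_pos (Nat.succ_le_of_lt hlt)
      rw [binomSum]
      simp only [Nat.succ_eq_add_one] at this
      omega

/-- `turanBinom n k r` counts the `k`-subsets of `{0, …, n - 1}` that are injective mod `r`. -/
theorem turanBinom_eq (n k r : ℕ) : turanBinom n k r =
    {s : Finset ℕ | s ⊆ Finset.range n ∧ s.card = k ∧
      Set.InjOn (fun a : ℕ => a % r) (s : Set ℕ)}.ncard := by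
  rw [turanBinom, cliqueCount]
  rw [← Set.ncard_image_of_injective _ (Finset.map_injective (Fin.valEmbedding (n := n)))]
  congr 1
  ext s
  simp only [Set.mem_image, SimpleGraph.mem_cliqueSet_iff, SimpleGraph.isNClique_iff,
    Set.mem_ofPred_eq]
  constructor
  · rintro ⟨t, ⟨hc, hk⟩, rfl⟩
    refine ⟨?_, by simpa using hk, ?_⟩
    · intro a ha
      obtain ⟨x, -, rfl⟩ := Finset.mem_map.mp ha
      simp
    · intro a ha b hb hab
      obtain ⟨x, hx, rfl⟩ := Finset.mem_map.mp (Finset.mem_coe.mp ha)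
      obtain ⟨y, hy, rfl⟩ := Finset.mem_map.mp (Finset.mem_coe.mp hb)
      by_contra hne
      exact hc hx hy (fun h => hne (by rw [h])) hab
  · rintro ⟨hs, hk, hinj⟩
    refine ⟨s.attachFin (fun a ha => Finset.mem_range.mp (hs ha)), ⟨?_, ?_⟩, ?_⟩
    · intro x hx y hy hne
      simp only [Finset.mem_coe, Finset.mem_attachFin] at hx hy
      intro hab
      exact hne (Fin.ext (hinj hx hy hab))
    · simpa using hk
    · ext a
      simp only [Finset.mem_map, Finset.mem_attachFin, Fin.valEmbedding_apply]
      constructor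
      · rintro ⟨x, hx, rfl⟩; exact hx
      · intro ha; exact ⟨⟨a, Finset.mem_range.mp (hs ha)⟩, ha, rfl⟩

/-- The order-preserving enumeration of the numbers that are not `c` mod `r + 1`. -/
def skipRes (c r w : ℕ) : ℕ :=
  (r + 1) * (w / r) + (if w % r < c then w % r else w % r + 1)

theorem skipRes_mod (c r w : ℕ) (hr : 0 < r) :
    skipRes c r w % (r + 1) = (if w % r < c then w % r else w % r + 1) := by
  have := Nat.mod_lt w hr
  rw [skipRes, Nat.mul_add_mod, Nat.mod_eq_of_lt]
  split_ifs <;> omega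

theorem skipRes_div (c r w : ℕ) (hr : 0 < r) : skipRes c r w / (r + 1) = w / r := by
  have := Nat.mod_lt w hr
  have hlt : (if w % r < c then w % r else w % r + 1) < r + 1 := by split_ifs <;> omega
  rw [skipRes, Nat.mul_add_div (by omega), Nat.div_eq_of_lt hlt, Nat.add_zero]

theorem skipRes_mod_eq_iff (c r v w : ℕ) (hr : 0 < r) :
    skipRes c r v % (r + 1) = skipRes c r w % (r + 1) ↔ v % r = w % r := by
  rw [skipRes_mod c r v hr, skipRes_mod c r w hr]
  split_ifs <;> omega

theorem skipRes_injective (c r : ℕ) (hr : 0 < r) : Function.Injective (skipRes c r) := by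
  intro v w h
  have h1 : v % r = w % r := (skipRes_mod_eq_iff c r v w hr).mp (by rw [h])
  have h2 : v / r = w / r := by rw [← skipRes_div c r v hr, h, skipRes_div c r w hr]
  rw [← Nat.div_add_mod v r, ← Nat.div_add_mod w r, h1, h2]

theorem image_skipRes (n r : ℕ) (hr : 0 < r) :
    (Finset.range (n - n / (r + 1))).image (skipRes (n % (r + 1)) r) =
      (Finset.range n).filter (fun v => v % (r + 1) ≠ n % (r + 1)) := by
  have hn := Nat.div_add_mod n (r + 1)
  have hc := Nat.mod_lt n (show 0 < r + 1 by omega)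
  set Q := n / (r + 1)
  set c := n % (r + 1)
  have hN : n - Q = r * Q + c := by
    rw [← hn, add_mul]; omega
  ext v
  simp only [Finset.mem_image, Finset.mem_range, Finset.mem_filter]
  rw [hN]
  constructor
  · rintro ⟨w, hw, rfl⟩
    have hm := Nat.mod_lt w hr
    refine ⟨?_, ?_⟩
    · have hw' := Nat.div_add_mod w r
      rcases lt_trichotomy (w / r) Q with hlt | heq | hlt
      · have : (r + 1) * (w / r + 1) ≤ (r + 1) * Q := Nat.mul_le_mul_left _ hlt
        rw [skipRes]
        rw [mul_add] at this
        split_ifs <;> omega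
      · rw [heq] at hw'
        rw [skipRes, heq, if_pos (by omega)]
        omega
      · have : r * (Q + 1) ≤ r * (w / r) := Nat.mul_le_mul_left _ hlt
        rw [mul_add] at this
        omega
    · rw [skipRes_mod _ _ _ hr]
      split_ifs <;> omega
  · rintro ⟨hv, hne⟩
    have hv' := Nat.div_add_mod v (r + 1)
    have hm := Nat.mod_lt v (show 0 < r + 1 by omega)
    set q := v / (r + 1)
    set j := v % (r + 1)
    have hq : q ≤ Q := Nat.div_le_div_right hv.le
    have main : ∀ i, i < r → r * q + i < r * Q + c →
        (if i < c then i else i + 1) = j → ∃ w, w < r * Q + c ∧ skipRes c r w = v := by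
      intro i hi hlt hij
      refine ⟨r * q + i, hlt, ?_⟩
      rw [skipRes, Nat.mul_add_div hr, Nat.mul_add_mod, Nat.mod_eq_of_lt hi,
        Nat.div_eq_of_lt hi, Nat.add_zero, hij]
      exact hv'
    have hb : ∀ i, i < r → (q = Q → i < c) → r * q + i < r * Q + c := by
      intro i hi hic
      rcases hq.eq_or_lt with h | h
      · have := hic h
        rw [h]; omega
      · have : r * (q + 1) ≤ r * Q := Nat.mul_le_mul_left _ h
        rw [mul_add] at this
        omega
    have hqj : q = Q → j < c := by
      intro h
      rw [h] at hv'
      omega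
    rcases lt_or_gt_of_ne hne with h | h
    · exact main j (by omega) (hb j (by omega) (fun _ => h)) (if_pos h)
    · refine main (j - 1) (by omega) (hb _ (by omega) (fun e => ?_)) ?_
      · have := hqj e; omega
      · rw [if_neg (by omega)]; omega

theorem turanBinom_finite (n k r : ℕ) : {s : Finset ℕ | s ⊆ Finset.range n ∧ s.card = k ∧
      Set.InjOn (fun a : ℕ => a % r) (s : Set ℕ)}.Finite :=
  ((Finset.range n).powerset.finite_toSet).subset fun _ hs =>
    Finset.mem_coe.mpr (Finset.mem_powerset.mpr hs.1)

/-- Adding a vertex to a smallest part of a Turán graph. -/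
theorem turanBinom_succ (n k r : ℕ) : turanBinom (n + 1) (k + 1) (r + 1) =
    turanBinom n (k + 1) (r + 1) + turanBinom (n - n / (r + 1)) k r := by
  classical
  have link : turanBinom (n - n / (r + 1)) k r =
      {s : Finset ℕ | s ⊆ (Finset.range n).filter (fun v => v % (r + 1) ≠ n % (r + 1)) ∧
        s.card = k ∧ Set.InjOn (fun a : ℕ => a % (r + 1)) (s : Set ℕ)}.ncard := by
    rw [turanBinom_eq]
    rcases Nat.eq_zero_or_pos r with rfl | hr
    · congr 1
      ext s
      simp only [Set.mem_ofPred_eq, zero_add, Nat.div_one, Nat.sub_self, Finset.range_zero,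
        Finset.subset_empty, Nat.mod_one, ne_eq, not_true_eq_false, Finset.filter_false]
      constructor <;> (rintro ⟨rfl, h, -⟩; exact ⟨rfl, h, by simp⟩)
    · have hinj := skipRes_injective (n % (r + 1)) r hr
      rw [← Set.ncard_image_of_injective _ (Finset.image_injective hinj)]
      congr 1
      ext s
      rw [← image_skipRes n r hr]
      simp only [Set.mem_image, Set.mem_ofPred_eq]
      have hio : ∀ t : Finset ℕ, Set.InjOn (fun a : ℕ => a % (r + 1))
          ((t.image (skipRes (n % (r + 1)) r) : Finset ℕ) : Set ℕ) ↔
          Set.InjOn (fun a : ℕ => a % r) (t : Set ℕ) := by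
        intro t
        constructor
        · intro h a ha b hb hab
          apply hinj
          apply h (by simpa using ⟨a, ha, rfl⟩) (by simpa using ⟨b, hb, rfl⟩)
          exact (skipRes_mod_eq_iff _ r a b hr).mpr hab
        · intro h a ha b hb hab
          obtain ⟨x, hx, rfl⟩ := Finset.mem_image.mp (Finset.mem_coe.mp ha)
          obtain ⟨y, hy, rfl⟩ := Finset.mem_image.mp (Finset.mem_coe.mp hb)
          rw [h hx hy ((skipRes_mod_eq_iff _ r x y hr).mp hab)]
      constructor
      · rintro ⟨t, ⟨h1, h2, h3⟩, rfl⟩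
        exact ⟨Finset.image_subset_image h1, by rw [Finset.card_image_of_injective _ hinj, h2],
          (hio t).mpr h3⟩
      · rintro ⟨h1, h2, h3⟩
        obtain ⟨t, ht, rfl⟩ := Finset.subset_image_iff.mp h1
        exact ⟨t, ⟨by simpa using ht, by rw [← h2, Finset.card_image_of_injective _ hinj],
          (hio t).mp h3⟩, rfl⟩
  have hnot : ∀ s : Finset ℕ,
      s ⊆ (Finset.range n).filter (fun v => v % (r + 1) ≠ n % (r + 1)) → n ∉ s :=
    fun s hs hn => by simpa using hs hn
  rw [link, turanBinom_eq, turanBinom_eq]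
  rw [← Set.InjOn.ncard_image (f := insert n) (s := {s : Finset ℕ |
      s ⊆ (Finset.range n).filter (fun v => v % (r + 1) ≠ n % (r + 1)) ∧
        s.card = k ∧ Set.InjOn (fun a : ℕ => a % (r + 1)) (s : Set ℕ)})]
  · have hsub : insert n '' {s : Finset ℕ |
      s ⊆ (Finset.range n).filter (fun v => v % (r + 1) ≠ n % (r + 1)) ∧
        s.card = k ∧ Set.InjOn (fun a : ℕ => a % (r + 1)) (s : Set ℕ)} ⊆
        {s : Finset ℕ | s ⊆ Finset.range (n + 1) ∧ s.card = k + 1 ∧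
          Set.InjOn (fun a : ℕ => a % (r + 1)) (s : Set ℕ)} := by
      rintro _ ⟨s, ⟨h1, h2, h3⟩, rfl⟩
      refine ⟨?_, by rw [Finset.card_insert_of_notMem (hnot s h1), h2], ?_⟩
      · intro a ha
        rcases Finset.mem_insert.mp ha with rfl | ha
        · simp
        · have := (Finset.mem_filter.mp (h1 ha)).1
          simp only [Finset.mem_range] at this ⊢
          omega
      · rw [Finset.coe_insert, Set.injOn_insert (by simpa using hnot s h1)]
        refine ⟨h3, ?_⟩
        rintro ⟨a, ha, hab⟩
        exact (Finset.mem_filter.mp (h1 ha)).2 hab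
    rw [← Set.ncard_union_eq ?_ (turanBinom_finite _ _ _)
      ((turanBinom_finite _ _ _).subset hsub)]
    · congr 1
      apply Set.Subset.antisymm
      · rintro s ⟨h1, h2, h3⟩
        by_cases hn : n ∈ s
        · right
          refine ⟨s.erase n, ⟨?_, by rw [Finset.card_erase_of_mem hn, h2]; rfl,
            h3.mono (by simp)⟩, Finset.insert_erase hn⟩
          intro a ha
          obtain ⟨hne, ha⟩ := Finset.mem_erase.mp ha
          have := h1 ha
          refine Finset.mem_filter.mpr ⟨?_, fun h => hne (h3 ha hn h)⟩
          simp only [Finset.mem_range] at this ⊢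
          omega
        · left
          refine ⟨fun a ha => ?_, h2, h3⟩
          have := h1 ha
          have hne : a ≠ n := fun h => hn (h ▸ ha)
          simp only [Finset.mem_range] at this ⊢
          omega
      · refine Set.union_subset ?_ hsub
        rintro s ⟨h1, h2, h3⟩
        exact ⟨h1.trans (Finset.range_mono (by omega)), h2, h3⟩
    · rw [Set.disjoint_left]
      rintro _ ⟨h1, -⟩ ⟨s, -, rfl⟩
      simpa using h1 (Finset.mem_insert_self n s)
  · intro s hs t ht hst
    rw [← Finset.erase_insert (hnot s hs.1), hst, Finset.erase_insert (hnot t ht.1)]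

theorem turanBinom_mono (k r : ℕ) : Monotone (fun n => turanBinom n k r) := by
  intro a b hab
  simp only [turanBinom_eq]
  refine Set.ncard_le_ncard ?_ (turanBinom_finite _ _ _)
  rintro s ⟨h1, h2, h3⟩
  exact ⟨h1.trans (Finset.range_mono hab), h2, h3⟩

theorem turanBinom_pos (n k r : ℕ) (hn : k ≤ n) (hr : k ≤ r) : 0 < turanBinom n k r := by
  rw [turanBinom_eq, Set.ncard_pos (turanBinom_finite _ _ _)]
  refine ⟨Finset.range k, Finset.range_mono hn, by simp, ?_⟩
  intro a ha b hb hab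
  simp only [Finset.coe_range, Set.mem_Iio] at ha hb
  simpa only [Nat.mod_eq_of_lt (show a < r by omega), Nat.mod_eq_of_lt (show b < r by omega)]
    using hab

theorem turanBinom_one (n r : ℕ) : turanBinom n 1 (r + 1) = n := by
  induction n with
  | zero =>
    rw [turanBinom_eq, Set.ncard_eq_zero (turanBinom_finite _ _ _), Set.eq_empty_iff_forall_notMem]
    rintro s ⟨h1, h2, -⟩
    simp only [Finset.range_zero, Finset.subset_empty] at h1
    simp [h1] at h2
  | succ n ih =>
    rw [turanBinom_succ, ih]
    congr 1
    rw [turanBinom_eq, Set.ncard_eq_one]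
    refine ⟨∅, ?_⟩
    ext s
    simp only [Set.mem_ofPred_eq, Finset.card_eq_zero, Set.mem_singleton_iff]
    constructor
    · rintro ⟨-, h, -⟩; exact h
    · rintro rfl; simp

theorem le_sub_div (k r n : ℕ) (hr : k ≤ r) (hn : k + 1 ≤ n) : k ≤ n - n / (r + 1) := by
  rcases lt_or_ge n (r + 1) with h | h
  · rw [Nat.div_eq_of_lt h]; omega
  · have h1 : 1 ≤ n / (r + 1) := (Nat.one_le_div_iff (by omega)).mpr h
    have h2 := Nat.div_mul_le_self n (r + 1)
    have h3 : r * 1 ≤ r * (n / (r + 1)) := Nat.mul_le_mul_left _ h1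
    rw [mul_add, mul_comm] at h2
    omega

theorem IsTuranRep.bounds {k r : ℕ} {L : List ℕ} (h : IsTuranRep k r L) (hr : k ≤ r) :
    0 < k ∧ k ≤ L.headD 0 ∧ turanBinom (L.headD 0) k r ≤ turanSum k r L ∧
      turanSum k r L < turanBinom (L.headD 0 + 1) k r := by
  induction h with
  | @single k r n hk hn =>
    obtain ⟨k, rfl⟩ : ∃ j, k = j + 1 := ⟨k - 1, by omega⟩
    obtain ⟨r, rfl⟩ : ∃ j, r = j + 1 := ⟨r - 1, by omega⟩
    have := turanBinom_pos (n - n / (r + 1)) k r (le_sub_div k r n (by omega) hn) (by omega)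
    simp only [List.headD_cons, turanSum, turanBinom_succ]
    omega
  | @cons k r n n' L hn h ih =>
    simp only [List.headD_cons] at ih ⊢
    obtain ⟨h1, h2, h3, h4⟩ := ih (by omega)
    have h5 : turanBinom (n' + 1) k r ≤ turanBinom (n - n / (r + 1)) k r :=
      turanBinom_mono k r hn
    have h6 : n - n / (r + 1) ≤ n := Nat.sub_le _ _
    refine ⟨by omega, by omega, ?_, ?_⟩
    · rw [turanSum]; omega
    · rw [turanSum, turanBinom_succ n k r, Nat.add_sub_cancel, Nat.add_sub_cancel]; omega

theorem IsTuranRep.headD_eq {k r : ℕ} {L L' : List ℕ} (hr : k ≤ r) (h : IsTuranRep k r L)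
    (h' : IsTuranRep k r L') (e : turanSum k r L = turanSum k r L') :
    L.headD 0 = L'.headD 0 := by
  have b := h.bounds hr
  have b' := h'.bounds hr
  rcases lt_trichotomy (L.headD 0) (L'.headD 0) with hlt | heq | hlt
  · have : turanBinom (L.headD 0 + 1) k r ≤ turanBinom (L'.headD 0) k r :=
      turanBinom_mono k r hlt
    omega
  · exact heq
  · have : turanBinom (L'.headD 0 + 1) k r ≤ turanBinom (L.headD 0) k r :=
      turanBinom_mono k r hlt
    omega

theorem IsTuranRep.unique {k r : ℕ} {L L' : List ℕ} (hr : k ≤ r) (h : IsTuranRep k r L)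
    (h' : IsTuranRep k r L') (e : turanSum k r L = turanSum k r L') : L = L' := by
  have key := IsTuranRep.headD_eq hr h h' e
  induction h generalizing L' with
  | @single k r n hk hn =>
    cases h' with
    | single _ _ => simp_all
    | @cons k r a a' T ha ht =>
      have b := ht.bounds (by omega)
      have := turanBinom_pos a' k r b.2.1 (by omega)
      simp only [List.headD_cons, turanSum, Nat.add_sub_cancel] at *
      subst key
      omega
  | @cons k r n n' T hn h ih =>
    cases h' with
    | single _ _ =>
      have b := h.bounds (by omega)
      have := turanBinom_pos n' k r b.2.1 (by omega)
      simp only [List.headD_cons, turanSum, Nat.add_sub_cancel] at *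
      subst key
      omega
    | @cons _ _ a a' T' ha ht =>
      simp only [List.headD_cons] at key
      subst key
      have e' : turanSum k r (n' :: T) = turanSum k r (a' :: T') := by
        rw [turanSum, turanSum.eq_def (k + 1) (r + 1) (n :: a' :: T')] at e
        simp only [Nat.add_sub_cancel] at e
        omega
      rw [ih (by omega) ht e' (IsTuranRep.headD_eq (by omega) h ht e')]

theorem exists_turanRep (k r m : ℕ) (hk : 0 < k) (hr : k ≤ r) (hm : 0 < m) :
    ∃ L, IsTuranRep k r L ∧ turanSum k r L = m := by
  induction k, hk using Nat.le_induction generalizing m r with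
  | base =>
    obtain ⟨r, rfl⟩ : ∃ j, r = j + 1 := ⟨r - 1, by omega⟩
    exact ⟨[m], .single one_pos hm, by simp [turanSum, turanBinom_one]⟩
  | succ k hk ih =>
    obtain ⟨r, rfl⟩ : ∃ j, r = j + 1 := ⟨r - 1, by omega⟩
    have hex : ∃ n, m < turanBinom (n + 1) (k + 1) (r + 1) := by
      refine ⟨m + k, ?_⟩
      have : turanBinom (m + k + 1) (k + 1) (r + 1) ≥ m + 1 := by
        clear ih hm
        induction m with
        | zero =>
          have := turanBinom_pos (0 + k + 1) (k + 1) (r + 1) (by omega) hr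
          omega
        | succ m ih =>
          have h0 := turanBinom_pos ((m + k + 1) - (m + k + 1) / (r + 1)) k r
            (le_sub_div k r _ (by omega) (by omega)) (by omega)
          have : m + 1 + k = m + k + 1 := by omega
          rw [this, turanBinom_succ]
          omega
      omega
    classical
    obtain ⟨n, hn, hmin⟩ : ∃ n, m < turanBinom (n + 1) (k + 1) (r + 1) ∧
        turanBinom n (k + 1) (r + 1) ≤ m := by
      refine ⟨Nat.find hex, Nat.find_spec hex, ?_⟩
      rcases Nat.eq_zero_or_pos (Nat.find hex) with h0 | hpos
      · rw [h0]
        have : turanBinom 0 (k + 1) (r + 1) ≤ turanBinom 0 1 (r + 1) := by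
          rw [turanBinom_eq, (Set.ncard_eq_zero (turanBinom_finite _ _ _)).mpr]
          · exact Nat.zero_le _
          · rw [Set.eq_empty_iff_forall_notMem]
            rintro s ⟨h1, h2, -⟩
            simp only [Finset.range_zero, Finset.subset_empty] at h1
            simp [h1] at h2
        rw [turanBinom_one] at this
        omega
      · have := Nat.find_min hex (m := Nat.find hex - 1) (by omega)
        rw [Nat.sub_add_cancel hpos] at this
        omega
    have hkn : k + 1 ≤ n := by
      by_contra hlt
      have h1 : turanBinom (n + 1) (k + 1) (r + 1) ≤ turanBinom (k + 1) (k + 1) (r + 1) :=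
        turanBinom_mono _ _ (show n + 1 ≤ k + 1 by omega)
      have h2 : turanBinom (k + 1) (k + 1) (r + 1) ≤ 1 := by
        rw [turanBinom_eq, Set.ncard_le_one (turanBinom_finite _ _ _)]
        have : ∀ s : Finset ℕ, s ⊆ Finset.range (k + 1) → s.card = k + 1 →
            s = Finset.range (k + 1) :=
          fun s h h' => Finset.eq_of_subset_of_card_le h (by simp [h'])
        rintro s ⟨h1, h2, -⟩ t ⟨h3, h4, -⟩
        rw [this s h1 h2, this t h3 h4]
      omega
    rcases hmin.eq_or_lt with heq | hlt
    · exact ⟨[n], .single (by omega) hkn, by simpa [turanSum] using heq⟩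
    · obtain ⟨L, hL, hs⟩ := ih r (m - turanBinom n (k + 1) (r + 1)) (by omega) (by omega)
      have b := hL.bounds (by omega)
      match L, hL with
      | n' :: T, hL =>
        refine ⟨n :: n' :: T, .cons ?_ hL, ?_⟩
        · simp only [List.headD_cons] at b
          by_contra hge
          have : turanBinom (n - n / (r + 1)) k r ≤ turanBinom n' k r :=
            turanBinom_mono k r (not_lt.mp hge)
          rw [turanBinom_succ] at hn
          omega
        · rw [turanSum, Nat.add_sub_cancel, Nat.add_sub_cancel, hs]; omega

theorem existsUnique_turanRep (k r m : ℕ) (hk : 0 < k) (hr : k ≤ r) (hm : 0 < m) :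
    ∃! L, IsTuranRep k r L ∧ turanSum k r L = m := by
  obtain ⟨L, hL, hs⟩ := exists_turanRep k r m hk hr hm
  exact ⟨L, ⟨hL, hs⟩, fun L' h' => h'.1.unique hr hL (h'.2.trans hs.symm)⟩

theorem turanRep_spec (k r m : ℕ) (hk : 0 < k) (hr : k ≤ r) (hm : 0 < m) :
    IsTuranRep k r (turanRep k r m) ∧ turanSum k r (turanRep k r m) = m := by
  have h := exists_turanRep k r m hk hr hm
  rw [turanRep, dif_pos h]
  exact h.choose_spec

/-!
The Kruskal-Katona bound is read as a statement about families of sets of natural numbers: for a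
family `B` of `k`-sets, `filled k B` is the family of `(k + 1)`-sets all of whose `k`-subsets lie
in `B`. The value `oldbd k m` is the size of `filled k C` for the initial segment `C` of the
colexicographic order with `m` sets (`card_filled_of_isInitSeg`), and Mathlib's Kruskal-Katona
theorem yields `card_filled_le`: it is an upper bound for all families of `m` sets.

The core is the analysis of equality, `exists_powersetCard_subset`: if `B` attains the bound and
`n.choose k ≤ B.card`, then `B` contains all `k`-subsets of some `n`-set. Choose an element `v`; let
`p` be the number of sets avoiding `v` and `b` the number of sets containing it. The filled sets
that avoid `v` are filled by the deletion, those through `v` correspond to members of the deletion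
that are filled by the link, and `oldbd_add_min_le` says that these two estimates add up to at most
the bound for `p + b`. Hence all of them are equalities, so the deletion attains the bound, and
either the link attains it or every set of the deletion is filled by the link. If
`n.choose k ≤ p`, induction applies to the deletion. Otherwise `p` and `b` are at least as large as
the numbers of `k`-subsets and `(k - 1)`-subsets of an `(n - 1)`-set, and induction gives an
`(n - 1)`-set that is complete both in the deletion and in the link; adding `v` makes it an
`n`-set. That `b` is not too small rests on the strict inequality `oldbd_add_lt`, which by
complementation in `{0, …, n - 1}` becomes strict subadditivity of the minimal shadow size, and that
holds because two families can be glued along a common facet.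

Both parts of the proposition now follow from `card_lt_oldbd`. The cliques of a graph without an
`n_k`-clique cannot contain a complete family on `n_k` vertices. The value `smbd k m` is attained
by a family of sets with distinct residues mod `n_k - 1` (`exists_rainbow_families`), and among any
`n_k` numbers two are congruent mod `n_k - 1`.
-/

namespace KruskalKatona

open Finset Finset.Colex
open scoped FinsetFamily

/-! ### Initial segments of the colexicographic order on sets of natural numbers -/

theorem shadow_image_image {α β : Type*} [DecidableEq α] [DecidableEq β] {f : α → β}
    (hf : Function.Injective f) (A : Finset (Finset α)) :
    ∂ (A.image (image f)) = (∂ A).image (image f) := by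
  ext t
  simp only [mem_shadow_iff, mem_image]
  constructor
  · rintro ⟨_, ⟨s, hs, rfl⟩, a, ha, rfl⟩
    obtain ⟨x, hx, rfl⟩ := mem_image.mp ha
    exact ⟨s.erase x, ⟨s, hs, x, hx, rfl⟩, image_erase hf s x⟩
  · rintro ⟨_, ⟨s, hs, x, hx, rfl⟩, rfl⟩
    exact ⟨s.image f, ⟨s, hs, rfl⟩, f x, mem_image_of_mem f hx, (image_erase hf s x).symm⟩

theorem sized_image_image {α β : Type*} [DecidableEq β] {f : α → β}
    (hf : Function.Injective f) {A : Finset (Finset α)} {r : ℕ}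
    (hA : (A : Set (Finset α)).Sized r) :
    ((A.image (image f) : Finset (Finset β)) : Set (Finset β)).Sized r := by
  intro t ht
  obtain ⟨s, hs, rfl⟩ := mem_image.mp (mem_coe.mp ht)
  rw [card_image_of_injective s hf, hA hs]

theorem exists_image_val_eq {N : ℕ} {s : Finset ℕ} (hs : s ⊆ range N) :
    ∃ t : Finset (Fin N), t.image Fin.val = s := by
  refine ⟨univ.filter (fun x => (x : ℕ) ∈ s), ?_⟩
  ext a
  simp only [mem_image, mem_filter, mem_univ, true_and]
  constructor
  · rintro ⟨x, hx, rfl⟩; exact hx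
  · intro ha
    exact ⟨⟨a, mem_range.mp (hs ha)⟩, ha, rfl⟩

theorem exists_image_image_val_eq {N : ℕ} {A : Finset (Finset ℕ)}
    (hA : ∀ s ∈ A, s ⊆ range N) :
    ∃ A' : Finset (Finset (Fin N)), A'.image (image Fin.val) = A := by
  refine ⟨univ.filter (fun s => s.image Fin.val ∈ A), ?_⟩
  ext s
  simp only [mem_image, mem_filter, mem_univ, true_and]
  constructor
  · rintro ⟨t, ht, rfl⟩; exact ht
  · intro hs
    obtain ⟨t, rfl⟩ := exists_image_val_eq (hA s hs)
    exact ⟨t, hs, rfl⟩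

theorem exists_subset_range (A : Finset (Finset ℕ)) : ∃ N, ∀ s ∈ A, s ⊆ range N := by
  refine ⟨(A.sup id).sup id + 1, fun s hs a ha => ?_⟩
  have h : a ∈ A.sup id := mem_sup.mpr ⟨s, hs, ha⟩
  have : a ≤ (A.sup id).sup id := le_sup (f := id) h
  exact mem_range.mpr (by omega)

theorem subset_range_of_le {N : ℕ} {s t : Finset ℕ} (hs : s ⊆ range N)
    (h : toColex t ≤ toColex s) : t ⊆ range N := fun a ha =>
  mem_range.mpr (forall_lt_mono h (fun _ hb => mem_range.mp (hs hb)) a ha)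

theorem isInitSeg_image_val {N r : ℕ} {A : Finset (Finset (Fin N))} :
    IsInitSeg (A.image (image Fin.val)) r ↔ IsInitSeg A r := by
  constructor
  · rintro ⟨h1, h2⟩
    refine ⟨fun s hs => ?_, fun s t hs ht => ?_⟩
    · rw [← h1 (mem_coe.mpr (mem_image_of_mem _ (mem_coe.mp hs))),
        card_image_of_injective s Fin.val_injective]
    · have := h2 (t := t.image Fin.val) (mem_image_of_mem (image Fin.val) hs)
        ⟨(toColex_image_lt_toColex_image Fin.val_strictMono).mpr ht.1, by
          rw [card_image_of_injective t Fin.val_injective, ht.2]⟩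
      obtain ⟨t', ht', e⟩ := mem_image.mp this
      rwa [← image_injective Fin.val_injective e]
  · rintro ⟨h1, h2⟩
    refine ⟨sized_image_image Fin.val_injective h1, fun s t hs ht => ?_⟩
    obtain ⟨s', hs', rfl⟩ := mem_image.mp hs
    obtain ⟨t', rfl⟩ := exists_image_val_eq (subset_range_of_le (N := N) (fun a ha => by
      obtain ⟨x, -, rfl⟩ := mem_image.mp ha
      exact mem_range.mpr x.2) ht.1.le)
    refine mem_image_of_mem _ (h2 hs' ⟨?_, ?_⟩)
    · exact (toColex_image_lt_toColex_image Fin.val_strictMono).mp ht.1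
    · rw [← ht.2, card_image_of_injective t' Fin.val_injective]

/-- The **Kruskal-Katona theorem** for families of finite sets of natural numbers. -/
theorem card_shadow_le_card_shadow {A C : Finset (Finset ℕ)} {r : ℕ}
    (hA : (A : Set (Finset ℕ)).Sized r) (hC : IsInitSeg C r) (h : C.card ≤ A.card) :
    (∂ C).card ≤ (∂ A).card := by
  obtain ⟨N, hN⟩ := exists_subset_range (A ∪ C)
  obtain ⟨A, rfl⟩ := exists_image_image_val_eq fun s hs => hN s (mem_union_left _ hs)
  obtain ⟨C, rfl⟩ := exists_image_image_val_eq fun s hs => hN s (mem_union_right _ hs)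
  have hinj := image_injective (Fin.val_injective (n := N))
  simp only [shadow_image_image Fin.val_injective, card_image_of_injective _ hinj] at h ⊢
  refine kruskal_katona (fun s hs => ?_) h (isInitSeg_image_val.mp hC)
  rw [← hA (mem_coe.mpr (mem_image_of_mem _ (mem_coe.mp hs))),
    card_image_of_injective s Fin.val_injective]

theorem isInitSeg_shadow {C : Finset (Finset ℕ)} {r : ℕ} (hC : IsInitSeg C r) :
    IsInitSeg (∂ C) (r - 1) := by
  obtain ⟨N, hN⟩ := exists_subset_range C
  obtain ⟨C, rfl⟩ := exists_image_image_val_eq hN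
  rw [shadow_image_image Fin.val_injective, isInitSeg_image_val]
  exact (isInitSeg_image_val.mp hC).shadow

theorem subset_of_card_le {C D : Finset (Finset ℕ)} {r : ℕ} (hC : IsInitSeg C r)
    (hD : IsInitSeg D r) (h : C.card ≤ D.card) : C ⊆ D := by
  rcases hC.total hD with h' | h'
  · exact h'
  · exact (eq_of_subset_of_card_le h' h).ge

theorem isInitSeg_powersetCard (n k : ℕ) : IsInitSeg (powersetCard k (range n)) k := by
  refine ⟨Set.sized_powersetCard _ _, fun s t hs ht => ?_⟩
  exact mem_powersetCard.mpr ⟨subset_range_of_le (mem_powersetCard.mp hs).1 ht.1.le, ht.2⟩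

theorem subset_powersetCard_range {C : Finset (Finset ℕ)} {k n : ℕ} (hC : IsInitSeg C k)
    (h : C.card ≤ n.choose k) : C ⊆ powersetCard k (range n) :=
  subset_of_card_le hC (isInitSeg_powersetCard n k) (by simpa using h)

/-- All `(k + 1)`-subsets of `{0, …, n - 1}`, together with the sets `{n} ∪ s` for `s ∈ C`. -/
def consSeg (k n : ℕ) (C : Finset (Finset ℕ)) : Finset (Finset ℕ) :=
  powersetCard (k + 1) (range n) ∪ C.image (insert n)

theorem insert_injOn {n : ℕ} {C : Finset (Finset ℕ)} (hC : ∀ s ∈ C, n ∉ s) :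
    Set.InjOn (insert n) (C : Set (Finset ℕ)) := by
  intro s hs t ht h
  rw [← erase_insert (hC s hs), h, erase_insert (hC t ht)]

theorem card_consSeg {k n : ℕ} {C : Finset (Finset ℕ)} (hC : C ⊆ powersetCard k (range n)) :
    (consSeg k n C).card = n.choose (k + 1) + C.card := by
  have hn : ∀ s ∈ C, n ∉ s := fun s hs h => by
    simpa using (mem_powersetCard.mp (hC hs)).1 h
  rw [consSeg, card_union_of_disjoint, card_image_of_injOn (insert_injOn hn),
    card_powersetCard, card_range]
  rw [disjoint_left]
  intro s hs hs'
  obtain ⟨t, -, rfl⟩ := mem_image.mp hs'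
  simpa using (mem_powersetCard.mp hs).1 (mem_insert_self n t)

theorem isInitSeg_consSeg {k n : ℕ} {C : Finset (Finset ℕ)} (hC : IsInitSeg C k)
    (hCn : C ⊆ powersetCard k (range n)) : IsInitSeg (consSeg k n C) (k + 1) := by
  have hn : ∀ s ∈ C, n ∉ s := fun s hs h => by
    simpa using (mem_powersetCard.mp (hCn hs)).1 h
  refine ⟨fun s hs => ?_, fun s t hs ht => ?_⟩
  · rcases mem_union.mp (mem_coe.mp hs) with h | h
    · exact (mem_powersetCard.mp h).2
    · obtain ⟨u, hu, rfl⟩ := mem_image.mp h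
      rw [card_insert_of_notMem (hn u hu), hC.1 hu]
  · rcases mem_union.mp hs with h | h
    · exact mem_union_left _ ((isInitSeg_powersetCard n (k + 1)).2 h ht)
    · obtain ⟨u, hu, rfl⟩ := mem_image.mp h
      have hun : u ⊆ range n := (mem_powersetCard.mp (hCn hu)).1
      have htn : t ⊆ range (n + 1) := subset_range_of_le (s := insert n u)
        (by rw [range_add_one]; exact insert_subset_insert n hun) ht.1.le
      by_cases hnt : n ∈ t
      · refine mem_union_right _ (mem_image.mpr ⟨t.erase n, hC.2 hu ⟨?_, ?_⟩, insert_erase hnt⟩)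
        · have e : u = (insert n u).erase n := (erase_insert (hn u hu)).symm
          have := toColex_sdiff_lt_toColex_sdiff (u := {n}) (s := t) (t := insert n u)
            (by simpa using hnt) (by simp)
          rw [sdiff_singleton_eq_erase, sdiff_singleton_eq_erase, ← e] at this
          exact this.mpr ht.1
        · rw [card_erase_of_mem hnt, ht.2]; rfl
      · refine mem_union_left _ (mem_powersetCard.mpr ⟨fun a ha => ?_, ht.2⟩)
        have h1 := mem_range.mp (htn ha)
        have h2 : a ≠ n := fun h => hnt (h ▸ ha)
        exact mem_range.mpr (by omega)

/-! ### Sets all of whose facets lie in a given family -/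

/-- For a family `B` of `k`-sets, the family of `(k + 1)`-sets all of whose `k`-subsets lie in
`B`. The ground set is the union of `B`, which excludes no such set as long as `0 < k`. -/
def filled (k : ℕ) (B : Finset (Finset ℕ)) : Finset (Finset ℕ) :=
  (powersetCard (k + 1) (B.sup id)).filter (fun T => ∀ x ∈ T, T.erase x ∈ B)

theorem mem_filled {k : ℕ} (hk : 0 < k) {B : Finset (Finset ℕ)} {T : Finset ℕ} :
    T ∈ filled k B ↔ T.card = k + 1 ∧ ∀ x ∈ T, T.erase x ∈ B := by
  rw [filled, mem_filter, mem_powersetCard]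
  refine ⟨fun h => ⟨h.1.2, h.2⟩, fun h => ⟨⟨fun x hx => ?_, h.1⟩, h.2⟩⟩
  obtain ⟨y, hy, hxy⟩ := exists_mem_ne (by omega : 1 < T.card) x
  exact mem_sup.mpr ⟨T.erase y, h.2 y hy, mem_erase.mpr ⟨hxy.symm, hx⟩⟩

theorem filled_mono {k : ℕ} (hk : 0 < k) {B C : Finset (Finset ℕ)} (h : B ⊆ C) :
    filled k B ⊆ filled k C := fun T hT => by
  rw [mem_filled hk] at hT ⊢
  exact ⟨hT.1, fun x hx => h (hT.2 x hx)⟩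

theorem sized_filled (k : ℕ) (B : Finset (Finset ℕ)) :
    (filled k B : Set (Finset ℕ)).Sized (k + 1) := fun _ hT =>
  (mem_powersetCard.mp (mem_filter.mp (mem_coe.mp hT)).1).2

theorem shadow_filled_subset (k : ℕ) (B : Finset (Finset ℕ)) : ∂ (filled k B) ⊆ B := by
  intro s hs
  obtain ⟨T, hT, x, hx, rfl⟩ := mem_shadow_iff.mp hs
  exact (mem_filter.mp hT).2 x hx

theorem filled_powersetCard {k : ℕ} (hk : 0 < k) (X : Finset ℕ) :
    filled k (powersetCard k X) = powersetCard (k + 1) X := by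
  ext T
  rw [mem_filled hk, mem_powersetCard]
  refine ⟨fun h => ⟨fun x hx => ?_, h.1⟩, fun h => ⟨h.2, fun x hx => mem_powersetCard.mpr
    ⟨(erase_subset _ _).trans h.1, by rw [card_erase_of_mem hx, h.2]; rfl⟩⟩⟩
  obtain ⟨y, hy, hxy⟩ := exists_mem_ne (by omega : 1 < T.card) x
  exact (mem_powersetCard.mp (h.2 y hy)).1 (mem_erase.mpr ⟨hxy.symm, hx⟩)

/-- A set filled by an initial segment stays filled when it moves down: its last facet arises by
removing its minimum, and that facet moves down as well. -/
theorem isInitSeg_filled {k : ℕ} (hk : 0 < k) {C : Finset (Finset ℕ)} (hC : IsInitSeg C k) :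
    IsInitSeg (filled k C) (k + 1) := by
  refine ⟨sized_filled k C, fun T S hT hS => ?_⟩
  rw [mem_filled hk] at hT ⊢
  refine ⟨hS.2, fun x hx => ?_⟩
  have hne : T.Nonempty := card_pos.mp (by omega)
  have hle := erase_le_erase_min' hS.1.le (by omega) hx
  have hmem := hT.2 _ (min'_mem T hne)
  rcases hle.eq_or_lt with h | h
  · rw [toColex_inj.mp h]; exact hmem
  · exact hC.2 hmem ⟨h, by rw [card_erase_of_mem hx, hS.2]; rfl⟩

theorem filled_consSeg {k n : ℕ} (hk : 0 < k) {C : Finset (Finset ℕ)}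
    (hC : C ⊆ powersetCard k (range n)) :
    filled (k + 1) (consSeg k n C) = consSeg (k + 1) n (filled k C) := by
  have hn : ∀ s ∈ C, n ∉ s := fun s hs h => by
    simpa using (mem_powersetCard.mp (hC hs)).1 h
  ext T
  rw [mem_filled k.succ_pos]
  constructor
  · rintro ⟨h1, h2⟩
    by_cases hnT : n ∈ T
    · refine mem_union_right _ (mem_image.mpr ⟨T.erase n, ?_, insert_erase hnT⟩)
      rw [mem_filled hk]
      refine ⟨by rw [card_erase_of_mem hnT, h1]; rfl, fun x hx => ?_⟩
      obtain ⟨hxn, hx⟩ := mem_erase.mp hx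
      rcases mem_union.mp (h2 x hx) with h | h
      · have := (mem_powersetCard.mp h).1 (mem_erase.mpr ⟨hxn.symm, hnT⟩)
        simp at this
      · obtain ⟨s, hs, e⟩ := mem_image.mp h
        rw [erase_right_comm, ← e, erase_insert (hn s hs)]
        exact hs
    · refine mem_union_left _ ?_
      rw [← filled_powersetCard k.succ_pos, mem_filled k.succ_pos]
      refine ⟨h1, fun x hx => ?_⟩
      rcases mem_union.mp (h2 x hx) with h | h
      · exact h
      · obtain ⟨s, hs, e⟩ := mem_image.mp h
        exact absurd (mem_of_mem_erase (e ▸ mem_insert_self n s)) hnT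
  · intro h
    rcases mem_union.mp h with h | h
    · rw [← filled_powersetCard k.succ_pos, mem_filled k.succ_pos] at h
      exact ⟨h.1, fun x hx => mem_union_left _ (h.2 x hx)⟩
    · obtain ⟨S, hS, rfl⟩ := mem_image.mp h
      have hSn : S ∈ powersetCard (k + 1) (range n) := by
        rw [← filled_powersetCard hk]
        exact filled_mono hk hC hS
      have hnS : n ∉ S := fun h => by simpa using (mem_powersetCard.mp hSn).1 h
      rw [mem_filled hk] at hS
      refine ⟨by rw [card_insert_of_notMem hnS, hS.1], fun x hx => ?_⟩
      rcases mem_insert.mp hx with rfl | hx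
      · rw [erase_insert hnS]
        exact mem_union_left _ hSn
      · rw [erase_insert_of_ne (fun e : n = x => hnS (e ▸ hx))]
        exact mem_union_right _ (mem_image_of_mem _ (hS.2 x hx))

theorem filled_subset_powersetCard {k n : ℕ} (hk : 0 < k) {C : Finset (Finset ℕ)}
    (hC : C ⊆ powersetCard k (range n)) : filled k C ⊆ powersetCard (k + 1) (range n) :=
  (filled_mono hk hC).trans (filled_powersetCard hk _).le

/-! ### The Kruskal-Katona bound as a count of filled sets -/

theorem exists_isInitSeg_of_isBinomRep {k : ℕ} {L : List ℕ} (h : IsBinomRep k L) :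
    ∃ C : Finset (Finset ℕ), IsInitSeg C k ∧ C.card = binomSum k L ∧
      (filled k C).card = binomSum (k + 1) L := by
  induction h with
  | @single k n hk hn =>
    exact ⟨powersetCard k (range n), isInitSeg_powersetCard n k, by simp [binomSum],
      by simp [binomSum, filled_powersetCard hk]⟩
  | @cons k n n' L hn h ih =>
    obtain ⟨C, hC, h1, h2⟩ := ih
    have b := h.bounds
    have hCn : C ⊆ powersetCard k (range n) := by
      refine subset_powersetCard_range hC ?_
      have := Nat.choose_le_choose k (Nat.succ_le_of_lt hn)
      simp only [List.headD_cons, Nat.succ_eq_add_one] at b this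
      omega
    refine ⟨consSeg k n C, isInitSeg_consSeg hC hCn, ?_, ?_⟩
    · rw [card_consSeg hCn, h1, binomSum.eq_def (k + 1) (n :: n' :: L)]
      rfl
    · rw [filled_consSeg b.1 hCn, card_consSeg (filled_subset_powersetCard b.1 hCn), h2,
        binomSum.eq_def (k + 1 + 1) (n :: n' :: L)]
      rfl

theorem oldbd_zero (k : ℕ) : oldbd k 0 = 0 := by
  have h : ¬ ∃ L, IsBinomRep k L ∧ binomSum k L = 0 := by
    rintro ⟨L, hL, h0⟩
    have b := hL.bounds
    have := Nat.choose_pos b.2.1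
    omega
  rw [oldbd, binomRep, dif_neg h, binomSum]

theorem exists_isInitSeg {k : ℕ} (hk : 0 < k) (m : ℕ) :
    ∃ C : Finset (Finset ℕ), IsInitSeg C k ∧ C.card = m := by
  rcases Nat.eq_zero_or_pos m with rfl | hm
  · exact ⟨∅, isInitSeg_empty, rfl⟩
  · obtain ⟨L, hL, hs⟩ := exists_binomRep k m hk hm
    obtain ⟨C, hC, h, -⟩ := exists_isInitSeg_of_isBinomRep hL
    exact ⟨C, hC, h.trans hs⟩

theorem card_filled_of_isInitSeg {k : ℕ} (hk : 0 < k) {C : Finset (Finset ℕ)}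
    (hC : IsInitSeg C k) : (filled k C).card = oldbd k C.card := by
  rcases Nat.eq_zero_or_pos C.card with h0 | hm
  · rw [h0, oldbd_zero, card_eq_zero, card_eq_zero.mp h0, eq_empty_iff_forall_notMem]
    intro T hT
    obtain ⟨h1, h2⟩ := (mem_filled hk).mp hT
    obtain ⟨x, hx⟩ := card_pos.mp (by omega : 0 < T.card)
    simpa using h2 x hx
  · obtain ⟨hL, hs⟩ := binomRep_spec k C.card hk hm
    obtain ⟨D, hD, h1, h2⟩ := exists_isInitSeg_of_isBinomRep hL
    have e : C = D := (subset_of_card_le hC hD (h1.trans hs).ge).antisymm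
      (subset_of_card_le hD hC (h1.trans hs).le)
    rw [oldbd, ← h2, e]

theorem oldbd_mono {k : ℕ} (hk : 0 < k) : Monotone (oldbd k) := by
  intro a b hab
  obtain ⟨C, hC, rfl⟩ := exists_isInitSeg hk a
  obtain ⟨D, hD, rfl⟩ := exists_isInitSeg hk b
  rw [← card_filled_of_isInitSeg hk hC, ← card_filled_of_isInitSeg hk hD]
  exact card_le_card (filled_mono hk (subset_of_card_le hC hD hab))

theorem oldbd_choose {k : ℕ} (hk : 0 < k) (n : ℕ) : oldbd k (n.choose k) = n.choose (k + 1) := by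
  have := card_filled_of_isInitSeg hk (isInitSeg_powersetCard n k)
  rw [filled_powersetCard hk] at this
  simpa using this.symm

/-- The recursion that peels off the leading term of the cascade. It also covers `m = n.choose k`,
where `n` is no longer the leading term. -/
theorem oldbd_choose_add {k : ℕ} (hk : 0 < k) {n m : ℕ} (hm : m ≤ n.choose k) :
    oldbd (k + 1) (n.choose (k + 1) + m) = n.choose (k + 2) + oldbd k m := by
  obtain ⟨C, hC, rfl⟩ := exists_isInitSeg hk m
  have hCn := subset_powersetCard_range hC hm
  rw [← card_filled_of_isInitSeg hk hC, ← card_consSeg hCn,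
    ← card_filled_of_isInitSeg k.succ_pos (isInitSeg_consSeg hC hCn), filled_consSeg hk hCn,
    card_consSeg (filled_subset_powersetCard hk hCn)]

/-- The Kruskal-Katona bound. If `filled k B` were larger than the filled family of the initial
segment `C` with `C.card = B.card`, then an initial segment with one more set than `filled k C`
would have a shadow strictly containing `C`. -/
theorem card_filled_le {k : ℕ} (hk : 0 < k) (B : Finset (Finset ℕ)) :
    (filled k B).card ≤ oldbd k B.card := by
  obtain ⟨C, hC, hCB⟩ := exists_isInitSeg hk B.card
  rw [← hCB, ← card_filled_of_isInitSeg hk hC]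
  by_contra! hlt
  obtain ⟨D, hD, hDC⟩ := exists_isInitSeg k.succ_pos ((filled k C).card + 1)
  have h1 : (∂ D).card ≤ C.card := by
    rw [hCB]
    exact (card_shadow_le_card_shadow (sized_filled k B) hD (by omega)).trans
      (card_le_card (shadow_filled_subset k B))
  have h2 : ∂ D ⊆ C := subset_of_card_le (isInitSeg_shadow hD) hC h1
  have h3 : D ⊆ filled k C := fun T hT =>
    (mem_filled hk).mpr ⟨hD.1 hT, fun x hx => h2 (erase_mem_shadow hT hx)⟩
  have := card_le_card h3
  omega

/-- Deleting a vertex splits a family of `p + b` sets of size `k + 1` into `p` sets and a link of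
`b` sets, and the bounds for the two parts do not exceed the bound for the whole. The extremal
family on the left consists of two initial segments joined by a new vertex. -/
theorem oldbd_add_min_le {k : ℕ} (hk : 0 < k) (p b : ℕ) :
    oldbd (k + 1) p + min p (oldbd k b) ≤ oldbd (k + 1) (p + b) := by
  obtain ⟨C, hC, rfl⟩ := exists_isInitSeg k.succ_pos p
  obtain ⟨D, hD, rfl⟩ := exists_isInitSeg hk b
  obtain ⟨N, hN⟩ := exists_subset_range (C ∪ D)
  have hNC : ∀ s ∈ C, N ∉ s := fun s hs h => by simpa using hN s (mem_union_left _ hs) h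
  have hND : ∀ s ∈ D, N ∉ s := fun s hs h => by simpa using hN s (mem_union_right _ hs) h
  have hdisj : ∀ E F : Finset (Finset ℕ), (∀ s ∈ E, N ∉ s) → Disjoint E (F.image (insert N)) := by
    intro E F hE
    rw [disjoint_left]
    intro s hs hs'
    obtain ⟨t, -, rfl⟩ := mem_image.mp hs'
    exact hE _ hs (mem_insert_self N t)
  have hcard : (C ∪ D.image (insert N)).card = C.card + D.card := by
    rw [card_union_of_disjoint (hdisj C D hNC), card_image_of_injOn (insert_injOn hND)]
  have hfC : ∀ T ∈ filled (k + 1) C, N ∉ T := fun T hT h => by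
    obtain ⟨h1, h2⟩ := (mem_filled k.succ_pos).mp hT
    obtain ⟨y, hy, hxy⟩ := exists_mem_ne (by omega : 1 < T.card) N
    exact hNC _ (h2 y hy) (mem_erase.mpr ⟨hxy.symm, h⟩)
  have hmin : min C.card (oldbd k D.card) = (C ∩ filled k D).card := by
    rw [← card_filled_of_isInitSeg hk hD]
    rcases hC.total (isInitSeg_filled hk hD) with h | h
    · rw [inter_eq_left.mpr h, min_eq_left (card_le_card h)]
    · rw [inter_eq_right.mpr h, min_eq_right (card_le_card h)]
  have hsub : filled (k + 1) C ∪ (C ∩ filled k D).image (insert N) ⊆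
      filled (k + 1) (C ∪ D.image (insert N)) := by
    refine union_subset (filled_mono k.succ_pos subset_union_left) fun T hT => ?_
    obtain ⟨S, hS, rfl⟩ := mem_image.mp hT
    obtain ⟨hSC, hSD⟩ := mem_inter.mp hS
    have hNS := hNC S hSC
    obtain ⟨h1, h2⟩ := (mem_filled hk).mp hSD
    rw [mem_filled k.succ_pos]
    refine ⟨by rw [card_insert_of_notMem hNS, h1], fun x hx => ?_⟩
    rcases mem_insert.mp hx with rfl | hx
    · rw [erase_insert hNS]
      exact mem_union_left _ hSC
    · rw [erase_insert_of_ne (fun e : N = x => hNS (e ▸ hx))]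
      exact mem_union_right _ (mem_image_of_mem _ (h2 x hx))
  have := (card_le_card hsub).trans (card_filled_le k.succ_pos _)
  rwa [hcard, card_union_of_disjoint (hdisj _ _ hfC), card_image_of_injOn
    (insert_injOn fun s hs => hNC s (mem_of_mem_inter_left hs)),
    card_filled_of_isInitSeg k.succ_pos hC, ← hmin] at this

/-! ### Complementation and the strict exchange inequality -/

/-- Two nonempty families of `q`-sets can be glued along a common `(q - 1)`-set, so the minimal
shadow size is strictly subadditive. -/
theorem card_shadow_lt_add {q : ℕ} (hq : 0 < q) {C D E : Finset (Finset ℕ)}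
    (hC : IsInitSeg C q) (hD : IsInitSeg D q) (hE : IsInitSeg E q) (hC0 : C.Nonempty)
    (hD0 : D.Nonempty) (hcard : E.card = C.card + D.card) :
    (∂ E).card < (∂ C).card + (∂ D).card := by
  obtain ⟨N, hN⟩ := exists_subset_range C
  -- `f` fixes `0, …, q - 2` and moves all other numbers beyond `C`.
  let f : ℕ → ℕ := fun x => if x < q - 1 then x else x + N
  have hf : Function.Injective f := by
    intro x y h
    simp only [f] at h
    split_ifs at h <;> omega
  have hstart : ∀ {F : Finset (Finset ℕ)}, IsInitSeg F q → F.Nonempty → range q ∈ F := by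
    intro F hF hF0
    have := card_pos.mpr hF0
    refine subset_of_card_le (isInitSeg_powersetCard q q) hF (by simpa using this) ?_
    simp
  have hdisj : Disjoint C (D.image (image f)) := by
    rw [disjoint_left]
    intro s hs hs'
    obtain ⟨t, ht, rfl⟩ := mem_image.mp hs'
    have hsub : t ⊆ range (q - 1) := by
      intro x hx
      have := mem_range.mp (hN _ hs (mem_image_of_mem f hx))
      simp only [f] at this
      rw [mem_range]
      by_contra hlt
      rw [if_neg hlt] at this
      omega
    have h1 := card_le_card hsub
    rw [hD.1 ht, card_range] at h1
    omega
  have herase : ∀ {F : Finset (Finset ℕ)}, IsInitSeg F q → F.Nonempty → range (q - 1) ∈ ∂ F := by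
    intro F hF hF0
    have h1 := erase_mem_shadow (hstart hF hF0) (mem_range.mpr (by omega : q - 1 < q))
    have h2 : (range q).erase (q - 1) = range (q - 1) := by
      ext x
      simp only [mem_erase, mem_range]
      omega
    rwa [h2] at h1
  have hfix : (range (q - 1)).image f = range (q - 1) := by
    conv_rhs => rw [← image_id (s := range (q - 1))]
    exact image_congr fun x hx => if_pos (mem_range.mp (mem_coe.mp hx))
  have hmeet : range (q - 1) ∈ ∂ C ∩ ∂ (D.image (image f)) := by
    refine mem_inter.mpr ⟨herase hC hC0, ?_⟩
    rw [shadow_image_image hf, ← hfix]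
    exact mem_image_of_mem _ (herase hD hD0)
  have hU : ((C ∪ D.image (image f) : Finset (Finset ℕ)) : Set (Finset ℕ)).Sized q := by
    rw [coe_union, Set.sized_union]
    exact ⟨hC.1, sized_image_image hf hD.1⟩
  have h1 := card_shadow_le_card_shadow hU hE (by
    rw [card_union_of_disjoint hdisj, card_image_of_injective _ (image_injective hf), hcard])
  have h2 : ∂ (C ∪ D.image (image f)) = ∂ C ∪ ∂ (D.image (image f)) := by
    ext s
    simp only [mem_shadow_iff, mem_union]
    grind
  have h3 := card_union_add_card_inter (∂ C) (∂ (D.image (image f)))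
  have h4 := card_pos.mpr ⟨_, hmeet⟩
  have h5 : (∂ (D.image (image f))).card = (∂ D).card := by
    rw [shadow_image_image hf, card_image_of_injective _ (image_injective hf)]
  rw [h2] at h1
  omega

/-- The `q`-subsets of `{0, …, n - 1}` whose complement is not in `C`. -/
def dual (n q : ℕ) (C : Finset (Finset ℕ)) : Finset (Finset ℕ) :=
  (powersetCard q (range n)).filter (fun s => range n \ s ∉ C)

theorem dual_subset (n q : ℕ) (C : Finset (Finset ℕ)) : dual n q C ⊆ powersetCard q (range n) :=
  filter_subset _ _

theorem range_sdiff_mem_powersetCard {n k q : ℕ} (h : k + q = n) {s : Finset ℕ}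
    (hs : s ∈ powersetCard q (range n)) : range n \ s ∈ powersetCard k (range n) := by
  obtain ⟨h1, h2⟩ := mem_powersetCard.mp hs
  refine mem_powersetCard.mpr ⟨sdiff_subset, ?_⟩
  rw [card_sdiff_of_subset h1, card_range, h2]
  omega

theorem card_dual_add {n k q : ℕ} (h : k + q = n) {C : Finset (Finset ℕ)}
    (hC : C ⊆ powersetCard k (range n)) : (dual n q C).card + C.card = n.choose k := by
  have h1 : C.card = ((powersetCard q (range n)).filter (fun s => range n \ s ∈ C)).card := by
    refine card_bij' (fun s _ => range n \ s) (fun s _ => range n \ s) ?_ ?_ ?_ ?_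
    · intro s hs
      have := (mem_powersetCard.mp (hC hs)).1
      rw [mem_filter, Finset.sdiff_sdiff_eq_self this]
      exact ⟨range_sdiff_mem_powersetCard (by omega) (hC hs), hs⟩
    · intro s hs
      exact (mem_filter.mp hs).2
    · intro s hs
      exact Finset.sdiff_sdiff_eq_self (mem_powersetCard.mp (hC hs)).1
    · intro s hs
      exact Finset.sdiff_sdiff_eq_self (mem_powersetCard.mp (mem_filter.mp hs).1).1
  have h2 := card_filter_add_card_filter_not (s := powersetCard q (range n))
    (fun s => range n \ s ∈ C)
  rw [card_powersetCard, card_range] at h2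
  rw [dual, h1, add_comm, h2]
  exact Nat.choose_symm_of_eq_add (by omega)

theorem dual_dual {n k q : ℕ} (h : k + q = n) {C : Finset (Finset ℕ)}
    (hC : C ⊆ powersetCard k (range n)) : dual n k (dual n q C) = C := by
  ext s
  rw [dual, mem_filter, dual, mem_filter]
  constructor
  · rintro ⟨h1, h2⟩
    by_contra hs
    refine h2 ⟨range_sdiff_mem_powersetCard (by omega) h1, ?_⟩
    rwa [Finset.sdiff_sdiff_eq_self (mem_powersetCard.mp h1).1]
  · intro hs
    refine ⟨hC hs, fun h' => h'.2 ?_⟩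
    rwa [Finset.sdiff_sdiff_eq_self (mem_powersetCard.mp (hC hs)).1]

/-- Complementation turns filled sets into sets outside the shadow. -/
theorem filled_dual {n k q : ℕ} (hk : 0 < k) {J : Finset (Finset ℕ)}
    (hJ : J ⊆ powersetCard q (range n)) :
    filled k (dual n k J) = dual n (k + 1) (∂ J) := by
  ext T
  rw [mem_filled hk, dual, dual, mem_filter, mem_powersetCard]
  have key : ∀ x ∈ T, T ⊆ range n → range n \ T.erase x = insert x (range n \ T) := by
    intro x hx hT
    ext y
    have := hT hx
    simp only [mem_sdiff, mem_erase, mem_insert]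
    grind
  constructor
  · rintro ⟨h1, h2⟩
    have hT : T ⊆ range n := by
      intro x hx
      obtain ⟨y, hy, hxy⟩ := exists_mem_ne (by omega : 1 < T.card) x
      exact (mem_powersetCard.mp (mem_filter.mp (h2 y hy)).1).1 (mem_erase.mpr ⟨hxy.symm, hx⟩)
    refine ⟨⟨hT, h1⟩, fun hs => ?_⟩
    obtain ⟨x, hx, hxJ⟩ := mem_shadow_iff_insert_mem.mp hs
    have hxn : x ∈ range n := (mem_powersetCard.mp (hJ hxJ)).1 (mem_insert_self x _)
    have hxT : x ∈ T := by
      by_contra h'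
      exact hx (mem_sdiff.mpr ⟨hxn, h'⟩)
    rw [← key x hxT hT] at hxJ
    exact (mem_filter.mp (h2 x hxT)).2 hxJ
  · rintro ⟨⟨hT, h1⟩, h2⟩
    refine ⟨h1, fun x hx => mem_filter.mpr ⟨mem_powersetCard.mpr
      ⟨(erase_subset _ _).trans hT, by rw [card_erase_of_mem hx, h1]; rfl⟩, fun hxJ => ?_⟩⟩
    rw [key x hx hT] at hxJ
    exact h2 (mem_shadow_iff_insert_mem.mpr ⟨x, by simp [hx], hxJ⟩)

theorem card_filled_dual_add {n k q : ℕ} (hk : 0 < k) (h : k + (q + 1) = n)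
    {J : Finset (Finset ℕ)} (hJ : J ⊆ powersetCard (q + 1) (range n)) :
    (filled k (dual n k J)).card + (∂ J).card = n.choose (k + 1) := by
  rw [filled_dual hk hJ]
  have hsub : ∂ J ⊆ powersetCard q (range n) := by
    intro s hs
    obtain ⟨T, hT, x, hx, rfl⟩ := mem_shadow_iff.mp hs
    obtain ⟨h1, h2⟩ := mem_powersetCard.mp (hJ hT)
    exact mem_powersetCard.mpr ⟨(erase_subset _ _).trans h1, by
      rw [card_erase_of_mem hx, h2]; rfl⟩
  have := card_dual_add (n := n) (k := q) (q := k + 1) (by omega) hsub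
  rw [this]
  exact Nat.choose_symm_of_eq_add (by omega)

/-- Passing to complements in `{0, …, n - 1}`, this is strict subadditivity of the minimal
shadow size, applied to the complementary amounts `n.choose k - x` and `n.choose k - y`. -/
theorem oldbd_add_lt {n k : ℕ} (hk : 0 < k) (hkn : k < n) {x y : ℕ} (hx : x < n.choose k)
    (hy : y < n.choose k) (hxy : n.choose k ≤ x + y) :
    oldbd k x + oldbd k y < n.choose (k + 1) + oldbd k (x + y - n.choose k) := by
  obtain ⟨q, hq⟩ : ∃ q, k + (q + 1) = n := ⟨n - k - 1, by omega⟩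
  -- A family of `z` sets misses `n.choose k - z` sets, and their complements have a shadow at
  -- least as large as that of an initial segment.
  have upper : ∀ z < n.choose k, ∃ J : Finset (Finset ℕ), IsInitSeg J (q + 1) ∧ J.Nonempty ∧
      J.card + z = n.choose k ∧ oldbd k z + (∂ J).card ≤ n.choose (k + 1) := by
    intro z hz
    obtain ⟨C, hC, rfl⟩ := exists_isInitSeg hk z
    obtain ⟨J, hJ, hJc⟩ := exists_isInitSeg (k := q + 1) (by omega) (n.choose k - C.card)
    have hCn := subset_powersetCard_range hC hz.le
    have h1 := card_dual_add hq hCn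
    have h2 := card_filled_dual_add hk hq (dual_subset n (q + 1) C)
    rw [dual_dual hq hCn, card_filled_of_isInitSeg hk hC] at h2
    have h3 := card_shadow_le_card_shadow (A := dual n (q + 1) C)
      (fun s hs => (mem_powersetCard.mp (dual_subset _ _ _ (mem_coe.mp hs))).2) hJ (by omega)
    exact ⟨J, hJ, card_pos.mp (by omega), by omega, by omega⟩
  obtain ⟨J₁, hJ₁, h1, h1', h1''⟩ := upper x hx
  obtain ⟨J₂, hJ₂, h2, h2', h2''⟩ := upper y hy
  obtain ⟨J, hJ, hJc⟩ := exists_isInitSeg (k := q + 1) (by omega) (J₁.card + J₂.card)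
  have hsymm : n.choose (q + 1) = n.choose k := (Nat.choose_symm_of_eq_add (by omega)).symm
  have hJn := subset_powersetCard_range (n := n) hJ (by omega)
  have h3 := card_shadow_lt_add q.succ_pos hJ₁ hJ₂ hJ h1 h2 hJc
  have h4 := card_filled_dual_add hk hq hJn
  have h5 := card_dual_add (k := q + 1) (q := k) (by omega) hJn
  have h6 := card_filled_le hk (dual n k J)
  have h7 : (dual n k J).card = x + y - n.choose k := by omega
  rw [h7] at h6
  omega

/-! ### Families attaining the bound contain a complete subfamily -/

/-- The deletion of `v`: the members of `B` that avoid `v`. -/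
def deletion (v : ℕ) (B : Finset (Finset ℕ)) : Finset (Finset ℕ) := B.filter (fun s => v ∉ s)

/-- The link of `v`: the sets `s` not containing `v` with `insert v s ∈ B`. -/
def link (v : ℕ) (B : Finset (Finset ℕ)) : Finset (Finset ℕ) :=
  (B.filter (fun s => v ∈ s)).image (fun s => s.erase v)

theorem mem_link {v : ℕ} {B : Finset (Finset ℕ)} {s : Finset ℕ} :
    s ∈ link v B ↔ v ∉ s ∧ insert v s ∈ B := by
  simp only [link, mem_image, mem_filter]
  constructor
  · rintro ⟨t, ⟨h1, h2⟩, rfl⟩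
    exact ⟨notMem_erase v t, by rwa [insert_erase h2]⟩
  · rintro ⟨h1, h2⟩
    exact ⟨insert v s, ⟨h2, mem_insert_self v s⟩, erase_insert h1⟩

theorem card_link (v : ℕ) (B : Finset (Finset ℕ)) :
    (link v B).card = (B.filter (fun s => v ∈ s)).card :=
  card_image_of_injOn fun s hs t ht h => by
    rw [← insert_erase (mem_filter.mp (mem_coe.mp hs)).2, h,
      insert_erase (mem_filter.mp (mem_coe.mp ht)).2]

theorem card_deletion_add_card_link (v : ℕ) (B : Finset (Finset ℕ)) :
    (deletion v B).card + (link v B).card = B.card := by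
  rw [card_link, add_comm]
  exact card_filter_add_card_filter_not _

theorem sized_link {v k : ℕ} {B : Finset (Finset ℕ)} (hB : (B : Set (Finset ℕ)).Sized (k + 1)) :
    (link v B : Set (Finset ℕ)).Sized k := fun s hs => by
  obtain ⟨h1, h2⟩ := mem_link.mp (mem_coe.mp hs)
  have := hB h2
  rw [card_insert_of_notMem h1] at this
  omega

theorem deletion_filled_subset {k : ℕ} (hk : 0 < k) (v : ℕ) (B : Finset (Finset ℕ)) :
    deletion v (filled k B) ⊆ filled k (deletion v B) := fun T hT => by
  obtain ⟨h1, h2⟩ := mem_filter.mp hT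
  obtain ⟨h3, h4⟩ := (mem_filled hk).mp h1
  exact (mem_filled hk).mpr ⟨h3, fun x hx =>
    mem_filter.mpr ⟨h4 x hx, fun h => h2 (mem_of_mem_erase h)⟩⟩

theorem link_filled_subset_deletion (k v : ℕ) (B : Finset (Finset ℕ)) :
    link v (filled k B) ⊆ deletion v B := fun s hs => by
  obtain ⟨h1, h2⟩ := mem_link.mp hs
  have := (mem_filter.mp h2).2 v (mem_insert_self v s)
  rw [erase_insert h1] at this
  exact mem_filter.mpr ⟨this, h1⟩

theorem link_filled_subset_filled {k : ℕ} (hk : 0 < k) (v : ℕ) (B : Finset (Finset ℕ)) :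
    link v (filled (k + 1) B) ⊆ filled k (link v B) := fun s hs => by
  obtain ⟨h1, h2⟩ := mem_link.mp hs
  obtain ⟨h3, h4⟩ := (mem_filled k.succ_pos).mp h2
  rw [card_insert_of_notMem h1] at h3
  refine (mem_filled hk).mpr ⟨by omega, fun x hx =>
    mem_link.mpr ⟨fun h => h1 (mem_of_mem_erase h), ?_⟩⟩
  rw [← erase_insert_of_ne (fun e : v = x => h1 (e ▸ hx))]
  exact h4 x (mem_insert_of_mem hx)

/-- A complete family on `X` that avoids `v` and is filled by the link of `v` extends by `v`. -/
theorem powersetCard_insert_subset {k v : ℕ} (hk : 0 < k) {B : Finset (Finset ℕ)} {X : Finset ℕ}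
    (hX : k + 1 ≤ X.card) (hdel : powersetCard (k + 1) X ⊆ deletion v B)
    (hlink : powersetCard (k + 1) X ⊆ filled k (link v B)) :
    v ∉ X ∧ powersetCard (k + 1) (insert v X) ⊆ B := by
  have hv : v ∉ X := by
    intro hv
    obtain ⟨t, h1, h2, h3⟩ := exists_subsuperset_card_eq (singleton_subset_iff.mpr hv)
      (by simp) hX
    exact (mem_filter.mp (hdel (mem_powersetCard.mpr ⟨h2, h3⟩))).2
      (h1 (mem_singleton_self v))
  refine ⟨hv, fun s hs => ?_⟩
  obtain ⟨h1, h2⟩ := mem_powersetCard.mp hs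
  by_cases hvs : v ∈ s
  · have hsub : s.erase v ⊆ X := fun a ha =>
      (mem_insert.mp (h1 (mem_of_mem_erase ha))).resolve_left (ne_of_mem_erase ha)
    have hcard : (s.erase v).card = k := by rw [card_erase_of_mem hvs, h2]; rfl
    obtain ⟨x, hx, hxs⟩ := exists_mem_notMem_of_card_lt_card (by omega : (s.erase v).card < X.card)
    have hmem := ((mem_filled hk).mp (hlink (mem_powersetCard.mpr
      ⟨insert_subset hx hsub, by rw [card_insert_of_notMem hxs, hcard]⟩))).2 x
      (mem_insert_self x _)
    rw [erase_insert hxs] at hmem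
    have := (mem_link.mp hmem).2
    rwa [insert_erase hvs] at this
  · refine (mem_filter.mp (hdel (mem_powersetCard.mpr ⟨fun a ha => ?_, h2⟩))).1
    exact (mem_insert.mp (h1 ha)).resolve_left (fun e => hvs (e ▸ ha))

/-- Equality in the Kruskal-Katona bound forces a complete subfamily of the size that the number
of sets allows. The proof removes a vertex `v` and applies induction to its deletion or its link,
both of which inherit equality. -/
theorem exists_powersetCard_subset {k n : ℕ} (hk : 0 < k) (hkn : k ≤ n) {B : Finset (Finset ℕ)}
    (hB : (B : Set (Finset ℕ)).Sized k) (hn : n.choose k ≤ B.card)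
    (h : oldbd k B.card ≤ (filled k B).card) :
    ∃ X : Finset ℕ, X.card = n ∧ powersetCard k X ⊆ B := by
  induction k, hk using Nat.le_induction generalizing n B with
  | base =>
    -- A family of singletons contains all singletons of its union.
    obtain ⟨C, hCB, hC⟩ := exists_subset_card_eq (by simpa using hn : n ≤ B.card)
    have hsingle : ∀ s ∈ C, ∃ a, s = {a} := fun s hs => card_eq_one.mp (hB (hCB hs))
    refine ⟨C.biUnion id, ?_, fun s hs => ?_⟩
    · rw [card_biUnion, sum_congr rfl (fun s hs => (hB (hCB hs) : (id s).card = 1)), sum_const, hC,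
        smul_eq_mul, mul_one]
      intro s hs t ht hst
      obtain ⟨a, rfl⟩ := hsingle s hs
      obtain ⟨b, rfl⟩ := hsingle t ht
      exact disjoint_singleton.mpr fun h => hst (h ▸ rfl)
    · obtain ⟨hs1, hs2⟩ := mem_powersetCard.mp hs
      obtain ⟨a, rfl⟩ := card_eq_one.mp hs2
      obtain ⟨t, ht, hat⟩ := mem_biUnion.mp (hs1 (mem_singleton_self a))
      obtain ⟨b, rfl⟩ := hsingle t ht
      rw [mem_singleton.mp hat]
      exact hCB ht
  | succ k hk ihk =>
    induction hm : B.card using Nat.strong_induction_on generalizing n B with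
    | _ m ihm =>
    subst hm
    have hBpos : 0 < B.card := (Nat.choose_pos hkn).trans_le hn
    rcases hkn.eq_or_lt with rfl | hlt
    · obtain ⟨s, hs⟩ := card_pos.mp hBpos
      refine ⟨s, hB hs, ?_⟩
      rw [← hB hs, powersetCard_self]
      simpa using hs
    obtain ⟨s₀, hs₀⟩ := card_pos.mp hBpos
    obtain ⟨v, hv⟩ := card_pos.mp (by have := hB hs₀; omega : 0 < s₀.card)
    have hlpos : 0 < (link v B).card := by
      rw [card_link]
      exact card_pos.mpr ⟨s₀, mem_filter.mpr ⟨hs₀, hv⟩⟩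
    have hpb := card_deletion_add_card_link v B
    have hfill := card_deletion_add_card_link v (filled (k + 1) B)
    have h1 := card_le_card (deletion_filled_subset k.succ_pos v B)
    have h2 := card_filled_le k.succ_pos (deletion v B)
    have h3 := card_le_card (link_filled_subset_deletion (k + 1) v B)
    have h4 := card_le_card (link_filled_subset_filled hk v B)
    have h5 := card_filled_le hk (link v B)
    have h6 := oldbd_add_min_le hk (deletion v B).card (link v B).card
    rw [hpb] at h6
    simp only [Nat.succ_eq_add_one] at h1 h2
    obtain ⟨n, rfl⟩ : ∃ j, n = j + 1 := ⟨n - 1, by omega⟩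
    have hsucc := Nat.choose_succ_succ' n k
    have hsucc' := Nat.choose_succ_succ' n (k + 1)
    have hBs : ((deletion v B : Finset _) : Set (Finset ℕ)).Sized (k + 1) :=
      fun s hs => hB (mem_filter.mp (mem_coe.mp hs)).1
    -- All the estimates are equalities; in particular the deletion attains the bound.
    have hdel : oldbd (k + 1) (deletion v B).card ≤ (filled (k + 1) (deletion v B)).card := by
      omega
    have hmin : min (deletion v B).card (oldbd k (link v B).card) ≤
      (link v (filled (k + 1) B)).card := by omega
    rcases le_or_gt ((n + 1).choose (k + 1)) (deletion v B).card with hp | hp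
    · obtain ⟨X, hX, hXB⟩ := ihm _ (by omega) hkn hBs hp hdel rfl
      exact ⟨X, hX, hXB.trans (filter_subset _ _)⟩
    -- The deletion is at least as large as a complete family on `n` vertices.
    have hp' : n.choose (k + 1) ≤ (deletion v B).card := by
      by_contra! hcon
      have h7 := oldbd_mono (k := k + 1) (by omega) hcon.le
      have h8 := oldbd_mono (k := k + 1) (by omega) hn
      rw [oldbd_choose (k := k + 1) (by omega)] at h7 h8
      omega
    -- Likewise the link is at least as large as a complete family on `n` vertices, by the strict
    -- exchange inequality.
    have hb : n.choose k ≤ (link v B).card := by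
      by_contra! hcon
      obtain ⟨p', hp'eq⟩ := Nat.exists_eq_add_of_le hp'
      have h7 := oldbd_add_lt hk (by omega : k < n) (x := p') (by omega) hcon (by omega)
      have h8 := oldbd_choose_add hk (by omega : p' ≤ n.choose k)
      have h9 := oldbd_choose_add hk (n := n + 1)
        (m := p' + (link v B).card - n.choose k) (by
          have := Nat.choose_le_choose k (Nat.le_succ n)
          simp only [Nat.succ_eq_add_one] at this
          omega)
      have h10 : (n + 1).choose (k + 1) + (p' + (link v B).card - n.choose k) = B.card := by
        omega
      rw [h10] at h9
      rw [← hp'eq] at h8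
      have h11 : (n + 1).choose (k + 2) = n.choose (k + 1) + n.choose (k + 2) := hsucc'
      omega
    -- Whichever estimate of the filled sets through `v` is tight, the deletion and the link fill
    -- a common `n`-set.
    have hX : ∃ X : Finset ℕ, X.card = n ∧ powersetCard (k + 1) X ⊆ deletion v B ∧
        powersetCard (k + 1) X ⊆ filled k (link v B) := by
      rcases le_total (oldbd k (link v B).card) (deletion v B).card with hle | hle
      · rw [min_eq_right hle] at hmin
        have e := eq_of_subset_of_card_le (link_filled_subset_filled hk v B) (by omega)
        obtain ⟨X, hX, hXl⟩ := ihk (by omega : k ≤ n) (sized_link hB) hb (by omega)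
        have hXf := filled_mono hk hXl
        rw [filled_powersetCard hk] at hXf
        refine ⟨X, hX, hXf.trans ?_, hXf⟩
        rw [← e]
        exact link_filled_subset_deletion _ _ _
      · rw [min_eq_left hle] at hmin
        have e := eq_of_subset_of_card_le (link_filled_subset_deletion (k + 1) v B) (by omega)
        obtain ⟨X, hX, hXd⟩ := ihm _ (by omega) (by omega : k + 1 ≤ n) hBs hp' hdel rfl
        refine ⟨X, hX, hXd, hXd.trans ?_⟩
        rw [← e]
        exact link_filled_subset_filled hk v B
    obtain ⟨X, hXn, hXd, hXl⟩ := hX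
    obtain ⟨hvX, hXB⟩ := powersetCard_insert_subset hk (by omega) hXd hXl
    exact ⟨insert v X, by rw [card_insert_of_notMem hvX, hXn], hXB⟩

/-- If every `n`-set contains a pair that lies in no member of `A`, then `A` is not the full family
of sets filled by `B`, or `B` contains no complete family on `n` elements; either way `A` stays
strictly below the bound. -/
theorem card_lt_oldbd {k : ℕ} (hk : 0 < k) {A B : Finset (Finset ℕ)}
    (hB : (B : Set (Finset ℕ)).Sized k) (hA : (A : Set (Finset ℕ)).Sized (k + 1))
    (hAB : ∀ T ∈ A, ∀ x ∈ T, T.erase x ∈ B) {n : ℕ} (hkn : k < n) (hn : n.choose k ≤ B.card)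
    (hfree : ∀ X : Finset ℕ, X.card = n → ∃ x ∈ X, ∃ y ∈ X, x ≠ y ∧ ∀ T ∈ A, x ∈ T → y ∉ T) :
    A.card < oldbd k B.card := by
  have hsub : A ⊆ filled k B := fun T hT => (mem_filled hk).mpr ⟨hA hT, hAB T hT⟩
  by_contra! hle
  have e : A = filled k B :=
    eq_of_subset_of_card_le hsub ((card_filled_le hk B).trans hle)
  obtain ⟨X, hX, hXB⟩ := exists_powersetCard_subset hk hkn.le hB hn (e ▸ hle)
  obtain ⟨x, hx, y, hy, hxy, hno⟩ := hfree X hX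
  have hsubX : ({x, y} : Finset ℕ) ⊆ X := insert_subset hx (singleton_subset_iff.mpr hy)
  obtain ⟨T, h1, h2, h3⟩ := exists_subsuperset_card_eq (n := k + 1) hsubX
    (by rw [card_pair hxy]; omega) (by omega)
  have hT : T ∈ A := by
    rw [e]
    refine filled_mono hk hXB ?_
    rw [filled_powersetCard hk]
    exact mem_powersetCard.mpr ⟨h2, h3⟩
  exact hno T hT (h1 (by simp)) (h1 (by simp))

/-! ### A colored family attaining the Turán-type bound -/

/-- The `k`-subsets of `{0, …, n - 1}` with distinct residues mod `r`, that is, the `k`-cliques of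
the Turán graph. -/
def rainbowSets (n k r : ℕ) : Finset (Finset ℕ) :=
  (powersetCard k (range n)).filter (fun s => Set.InjOn (fun a : ℕ => a % r) (s : Set ℕ))

theorem mem_rainbowSets {n k r : ℕ} {s : Finset ℕ} : s ∈ rainbowSets n k r ↔
    s ⊆ range n ∧ s.card = k ∧ Set.InjOn (fun a : ℕ => a % r) (s : Set ℕ) := by
  rw [rainbowSets, mem_filter, mem_powersetCard, and_assoc]

theorem card_rainbowSets (n k r : ℕ) : (rainbowSets n k r).card = turanBinom n k r := by
  rw [turanBinom_eq, ← Set.ncard_coe_finset]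
  congr 1
  ext s
  rw [mem_coe, mem_rainbowSets]
  rfl

/-- The `(k + 1)`-subsets of `{0, …, n - 1}` with distinct residues mod `r + 1`, joined with the sets
obtained from the members of `C` by relabelling their elements by `c` and adding `n`. -/
def consRainbow (n k r : ℕ) (c : ℕ → ℕ) (C : Finset (Finset ℕ)) : Finset (Finset ℕ) :=
  rainbowSets n (k + 1) (r + 1) ∪ C.image (fun s => insert n (s.image c))

/-- The sums `turanSum k r L` and `turanSum (k + 1) r L` count the `k`-sets and the `(k + 1)`-sets of
a simplicial complex whose faces have distinct residues mod `r`. The complex is in general not the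
clique complex of a graph, which is why the bounds are proved for set families. -/
theorem exists_rainbow_families {k r : ℕ} {L : List ℕ} (h : IsTuranRep k r L) (hkr : k ≤ r) :
    ∃ B A : Finset (Finset ℕ), B ⊆ rainbowSets (L.headD 0 + 1) k r ∧
      A ⊆ rainbowSets (L.headD 0 + 1) (k + 1) r ∧ (∀ T ∈ A, ∀ x ∈ T, T.erase x ∈ B) ∧
      B.card = turanSum k r L ∧ A.card = turanSum (k + 1) r L := by
  have hmono : ∀ n k r, rainbowSets n k r ⊆ rainbowSets (n + 1) k r := fun n k r s hs => by
    rw [mem_rainbowSets] at hs ⊢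
    exact ⟨hs.1.trans (range_mono (by omega)), hs.2⟩
  have herase : ∀ n k r, ∀ T ∈ rainbowSets n (k + 1) r, ∀ x ∈ T,
      T.erase x ∈ rainbowSets n k r := fun n k r T hT x hx => by
    rw [mem_rainbowSets] at hT ⊢
    exact ⟨(erase_subset _ _).trans hT.1, by rw [card_erase_of_mem hx, hT.2.1]; rfl,
      hT.2.2.mono (by simp)⟩
  induction h with
  | @single k r n hk hn =>
    refine ⟨rainbowSets n k r, rainbowSets n (k + 1) r, hmono _ _ _, hmono _ _ _,
      herase n k r, ?_, ?_⟩ <;> simp [turanSum, card_rainbowSets]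
  | @cons k r n n' L hn h ih =>
    obtain ⟨B, A, hB, hA, hAB, hBc, hAc⟩ := ih (by omega)
    have hk := (h.bounds (by omega)).1
    have hr : 0 < r := by omega
    simp only [List.headD_cons] at hB hA ⊢
    -- The vertices of the smaller Turán graph are placed outside the residue class of `n`.
    set c := skipRes (n % (r + 1)) r with hc
    have hcinj : Function.Injective c := skipRes_injective _ r hr
    have hmap : ∀ {j : ℕ} {s : Finset ℕ}, s ∈ rainbowSets (n' + 1) j r →
        s.image c ∈ rainbowSets n j (r + 1) ∧ ∀ a ∈ s.image c, a % (r + 1) ≠ n % (r + 1) := by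
      intro j s hs
      obtain ⟨h1, h2, h3⟩ := mem_rainbowSets.mp hs
      have hsub : s.image c ⊆ (range n).filter (fun v => v % (r + 1) ≠ n % (r + 1)) := by
        rw [← image_skipRes n r hr]
        exact image_subset_image (h1.trans (range_mono hn))
      refine ⟨mem_rainbowSets.mpr ⟨hsub.trans (filter_subset _ _), ?_, ?_⟩,
        fun a ha => (mem_filter.mp (hsub ha)).2⟩
      · rw [card_image_of_injective s hcinj, h2]
      · intro a ha b hb hab
        obtain ⟨x, hx, rfl⟩ := mem_image.mp (mem_coe.mp ha)
        obtain ⟨y, hy, rfl⟩ := mem_image.mp (mem_coe.mp hb)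
        rw [h3 hx hy ((skipRes_mod_eq_iff _ r x y hr).mp hab)]
    have hnot : ∀ {j : ℕ} {s : Finset ℕ}, s ∈ rainbowSets n j (r + 1) → n ∉ s := fun hs h => by
      simpa using (mem_rainbowSets.mp hs).1 h
    have hsub : ∀ {j : ℕ} {C : Finset (Finset ℕ)}, C ⊆ rainbowSets (n' + 1) j r →
        consRainbow n j r c C ⊆ rainbowSets (n + 1) (j + 1) (r + 1) := by
      intro j C hC
      refine union_subset (hmono _ _ _) fun t ht => ?_
      obtain ⟨s, hs, rfl⟩ := mem_image.mp ht
      obtain ⟨h1, h2⟩ := hmap (hC hs)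
      obtain ⟨h3, h4, h5⟩ := mem_rainbowSets.mp h1
      refine mem_rainbowSets.mpr ⟨?_, ?_, ?_⟩
      · rw [range_add_one]
        exact insert_subset_insert n h3
      · rw [card_insert_of_notMem (hnot h1), h4]
      · rw [coe_insert, Set.injOn_insert (by simpa using hnot h1)]
        refine ⟨h5, ?_⟩
        rintro ⟨a, ha, hab⟩
        exact h2 a ha hab
    have hcard : ∀ {j : ℕ} {C : Finset (Finset ℕ)}, C ⊆ rainbowSets (n' + 1) j r →
        (consRainbow n j r c C).card = turanBinom n (j + 1) (r + 1) + C.card := by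
      intro j C hC
      rw [consRainbow, card_union_of_disjoint, card_rainbowSets, card_image_of_injOn]
      · intro s hs t ht hst
        simp only at hst
        apply image_injective hcinj
        rw [← erase_insert (hnot (hmap (hC hs)).1), hst, erase_insert (hnot (hmap (hC ht)).1)]
      · rw [disjoint_left]
        intro s hs hs'
        obtain ⟨t, -, rfl⟩ := mem_image.mp hs'
        exact hnot hs (mem_insert_self n _)
    refine ⟨consRainbow n k r c B, consRainbow n (k + 1) r c A, hsub hB, hsub hA, ?_, ?_, ?_⟩
    · intro T hT x hx
      rcases mem_union.mp hT with hT | hT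
      · exact mem_union_left _ (herase _ _ _ T hT x hx)
      · obtain ⟨S, hS, rfl⟩ := mem_image.mp hT
        have h1 := (hmap (hA hS)).1
        rcases mem_insert.mp hx with rfl | hx
        · rw [erase_insert (hnot h1)]
          exact mem_union_left _ h1
        · have hne : n ≠ x := fun e => hnot h1 (e ▸ hx)
          obtain ⟨y, hy, rfl⟩ := mem_image.mp hx
          rw [erase_insert_of_ne hne, ← image_erase hcinj]
          exact mem_union_right _ (mem_image_of_mem (fun s => insert n (s.image c)) (hAB S hS y hy))
    · rw [hcard hB, hBc, turanSum.eq_def (k + 1) (r + 1) (n :: n' :: L)]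
      rfl
    · rw [hcard hA, hAc, turanSum.eq_def (k + 1 + 1) (r + 1) (n :: n' :: L)]
      rfl

theorem smbd_lt_oldbd {k m : ℕ} (hk : 0 < k) (hm : 0 < m) (hlt : k < leadingTerm k m) :
    smbd k m < oldbd k m := by
  obtain ⟨hL, hs⟩ := turanRep_spec k (leadingTerm k m - 1) m hk (by omega) hm
  obtain ⟨B, A, hB, hA, hAB, hBc, hAc⟩ := exists_rainbow_families hL (by omega)
  rw [hs] at hBc
  rw [smbd, ← hAc, ← hBc]
  refine card_lt_oldbd hk (fun s hs => (mem_rainbowSets.mp (hB hs)).2.1)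
    (fun s hs => (mem_rainbowSets.mp (hA hs)).2.1) hAB hlt ?_ fun X hX => ?_
  · rw [hBc]
    exact (leadingTerm_isGreatest k m hk hm).1
  · -- Among `n_k` numbers two are congruent mod `n_k - 1`.
    obtain ⟨x, hx, y, hy, hxy, hmod⟩ := exists_ne_map_eq_of_card_lt_of_maps_to
      (s := X) (t := range (leadingTerm k m - 1)) (f := fun a => a % (leadingTerm k m - 1))
      (by rw [card_range, hX]; omega)
      (fun a _ => by simpa using Nat.mod_lt a (by omega : 0 < leadingTerm k m - 1))
    refine ⟨x, hx, y, hy, hxy, fun T hT hxT hyT => hxy ?_⟩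
    exact (mem_rainbowSets.mp (hA hT)).2.2 hxT hyT hmod

/-! ### Cliques of a graph -/

theorem exists_cliqueFamily {V : Type*} [Finite V] (G : SimpleGraph V) (e : V ↪ ℕ) (i : ℕ) :
    ∃ A : Finset (Finset ℕ), A.card = cliqueCount G i ∧
      ∀ T, T ∈ A ↔ ∃ S, G.IsNClique i S ∧ S.map e = T := by
  have hfin : (G.cliqueSet i).Finite := Set.toFinite _
  refine ⟨hfin.toFinset.map (mapEmbedding e).toEmbedding, ?_, fun T => ?_⟩
  · rw [card_map, cliqueCount, Set.ncard_eq_toFinset_card _ hfin]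
  · simp only [mem_map, Set.Finite.mem_toFinset, SimpleGraph.mem_cliqueSet_iff]
    rfl

theorem cliqueCount_succ_lt_oldbd {V : Type*} [Finite V] (G : SimpleGraph V) {k n : ℕ}
    (hk : 0 < k) (hkn : k < n) (hn : n.choose k ≤ cliqueCount G k) (hfree : G.CliqueFree n) :
    cliqueCount G (k + 1) < oldbd k (cliqueCount G k) := by
  classical
  obtain ⟨N, ⟨f⟩⟩ := Finite.exists_equiv_fin V
  let e : V ↪ ℕ := f.toEmbedding.trans Fin.valEmbedding
  obtain ⟨B, hBc, hB⟩ := exists_cliqueFamily G e k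
  obtain ⟨A, hAc, hA⟩ := exists_cliqueFamily G e (k + 1)
  rw [← hBc] at hn
  rw [← hAc, ← hBc]
  refine card_lt_oldbd hk ?_ ?_ ?_ hkn hn ?_
  · intro T hT
    obtain ⟨S, hS, rfl⟩ := (hB T).mp hT
    rw [card_map, hS.card_eq]
  · intro T hT
    obtain ⟨S, hS, rfl⟩ := (hA T).mp hT
    rw [card_map, hS.card_eq]
  · intro T hT x hx
    obtain ⟨S, hS, rfl⟩ := (hA T).mp hT
    obtain ⟨v, hv, rfl⟩ := mem_map.mp hx
    refine (hB _).mpr ⟨S.erase v, ?_, map_erase e S v⟩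
    exact hS.erase_of_mem hv
  · intro X hX
    by_contra! hcon
    have hcon' : ∀ x ∈ X, ∀ y ∈ X, x ≠ y →
        ∃ u v, e u = x ∧ e v = y ∧ G.Adj u v := by
      intro x hx y hy hxy
      obtain ⟨T, hT, hxT, hyT⟩ := hcon x hx y hy hxy
      obtain ⟨S, hS, rfl⟩ := (hA T).mp hT
      obtain ⟨u, hu, rfl⟩ := mem_map.mp hxT
      obtain ⟨v, hv, rfl⟩ := mem_map.mp hyT
      exact ⟨u, v, rfl, rfl, hS.isClique hu hv (fun h => hxy (h ▸ rfl))⟩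
    have hXmap : (X.preimage e e.injective.injOn).map e = X := by
      rw [map_eq_image, image_preimage, filter_true_of_mem]
      intro x hx
      obtain ⟨y, hy, hyx⟩ := exists_mem_ne (by omega : 1 < X.card) x
      obtain ⟨u, -, hu, -⟩ := hcon' x hx y hy hyx.symm
      exact ⟨u, hu⟩
    refine hfree (X.preimage e e.injective.injOn) ⟨fun u hu v hv huv => ?_, ?_⟩
    · obtain ⟨u', v', h1, h2, h3⟩ := hcon' _ (mem_preimage.mp hu) _ (mem_preimage.mp hv)
        (fun h => huv (e.injective h))
      rwa [e.injective h1, e.injective h2] at h3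
    · rw [← hX, ← card_map e, hXmap]

end KruskalKatona

theorem proposition4p5 (k m : ℕ) (hk : 0 < k) (hm : 0 < m) (hpos : 0 < oldbd k m) :
    smbd k m < oldbd k m ∧
      ∀ (V : Type*) [Finite V] (G : SimpleGraph V),
        cliqueCount G k = m → G.CliqueFree (leadingTerm k m) →
          cliqueCount G (k + 1) < oldbd k m := by
  have hlt := (oldbd_pos_iff k m hk hm).mp hpos
  refine ⟨KruskalKatona.smbd_lt_oldbd hk hm hlt, fun V _ G hG hfree => ?_⟩
  have hn : (leadingTerm k m).choose k ≤ m := (leadingTerm_isGreatest k m hk hm).1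
  subst hG
  exact KruskalKatona.cliqueCount_succ_lt_oldbd G hk hlt hn hfree
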